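/- For positive integers $s_1,\dots,s_k$ and complex numbers $z_1,\dots,z_k$ with $|z_i|=1$ put $$\mathrm{Li}_{s_1,\dots,s_k}(z_1,\dots,z_k)=\sum_{n_1>\cdots>n_k\ge 1}\frac{z_1^{n_1}\cdots z_k^{n_k}}{n_1^{s_1}\cdots n_k^{s_k}} =\lim_{N\to\infty}\ \sum_{N\ge n_1>\cdots>n_k\ge 1}\frac{z_1^{n_1}\cdots z_k^{n_k}}{n_1^{s_1}\cdots n_k^{s_k}}$$ whenever the limit exists. Let $k,\ell\ge 1$, and let $\mathcal I_{k,\ell}$ be the set of pairs $(\varphi,\psi)$ of order preserving injections $\varphi:\{1,\dots,k\}\to\{1,\dots,k+\ell\}$ and $\psi:\{1,\dots,\ell\}\to\{1,\dots,k+\ell\}$ whose images are disjoint with union $\{1,\dots,k+\ell\}$. For $\vec r\in\mathbb Z_{\ge1}^k$, $\vec s\in\mathbb Z_{\ge1}^\ell$, $\vec t\in\mathbb Z_{\ge1}^{k+\ell}$ with $|\vec t|=|\vec r|+|\vec s|$ (where $|\cdot|$ is the sum of the entries), for $(\varphi,\psi)\in\mathcal I_{k,\ell}$ and $1\le i\le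 k+\ell$, let $h_i=r_j$ if $i=\varphi(j)$ and $h_i=s_j$ if $i=\psi(j)$, and $$c_{\vec r,\vec s}^{\vec t,(\varphi,\psi)}(i)=\begin{cases}\binom{t_i-1}{h_i-1} & \text{if } i=1, \text{ or } i-1,i\in\operatorname{im}\varphi, \text{ or } i-1,i\in\operatorname{im}\psi,\\[4pt] \binom{t_i-1}{\sum_{j=1}^i t_j-\sum_{j=1}^i h_j} & \text{otherwise,}\end{cases}$$ where $\binom{n}{m}=0$ for $m<0$ and for $m>n\ge 0$. For $\vec w\in(S^1)^k$ and $\vec z\in(S^1)^\ell$, where $S^1=\{z\in\mathbb C: |z|=1\}$, let $\vec w\,ш'_{(\varphi,\psi)}\,\vec z\in (S^1)^{k+\ell}$ be the vector with entries $$(\vec w\,ш'_{(\varphi,\psi)}\,\vec z)_i=\begin{cases} w_j & \text{if } i=\varphi(j) \text{ and either } i=1 \text{ or } i-1\in\operatorname{im}\varphi,\\ z_j & \text{if } i=\psi(j) \text{ and either } i=1 \text{ or } i-1\in\operatorname{im}\psi,\\ \dfrac{w_1\cdots w_j}{z_1\cdots z_{i-j}} & \text{if } i=\varphi(j) \text{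 and } i-1\in\operatorname{im}\psi,\\[6pt] \dfrac{z_1\cdots z_j}{w_1\cdots w_{i-j}} & \text{if } i=\psi(j) \text{ and } i-1\in\operatorname{im}\varphi.\end{cases}$$ Theorem. Let $k,\ell\ge1$, $\vec r\in\mathbb Z_{\ge1}^k$, $\vec s\in\mathbb Z_{\ge1}^\ell$, $\vec w\in(S^1)^k$ and $\vec z\in(S^1)^\ell$ with $(r_1,w_1)\ne(1,1)$ and $(s_1,z_1)\ne(1,1)$. Then the series $\mathrm{Li}_{\vec r}(\vec w)$ and $\mathrm{Li}_{\vec s}(\vec z)$ converge, the series $\mathrm{Li}_{\vec t}(\vec w\,ш'_{(\varphi,\psi)}\,\vec z)$ converges for all $\vec t$ and $(\varphi,\psi)$ as below for which $\prod_{i} c_{\vec r,\vec s}^{\vec t,(\varphi,\psi)}(i)\ne 0$, and $$\mathrm{Li}_{\vec r}(\vec w)\,\mathrm{Li}_{\vec s}(\vec z)=\sum_{\substack{\vec t\in\mathbb Z_{\ge1}^{k+\ell}\\ |\vec t|=|\vec r|+|\vec s|}}\ \sum_{(\varphi,\psi)\in\mathcal I_{k,\ell}}\Big(\prod_{i=1}^{k+\ell}c_{\vec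 r,\vec s}^{\vec t,(\varphi,\psi)}(i)\Big)\,\mathrm{Li}_{\vec t}(\vec w\,ш'_{(\varphi,\psi)}\,\vec z),$$ where terms whose coefficient is $0$ are read as $0$. -/

import Mathlib

open Filter Topology

namespace MPL

/-- The finite sum of `z₁^{n₁} ⋯ z_k^{n_k} / (n₁^{s₁} ⋯ n_k^{s_k})` over all integers
`N ≥ n₁ > ⋯ > n_k ≥ 1`. -/
noncomputable def partialSum {k : ℕ} (s : Fin k → ℕ) (z : Fin k → ℂ) (N : ℕ) : ℂ :=
  ∑ n ∈ (Fintype.piFinset fun _ : Fin k => Finset.Icc 1 N).filter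
      (fun n => ∀ i j, i < j → n j < n i),
    ∏ i, z i ^ n i / (n i : ℂ) ^ s i

/-- Convergence of the multiple polylogarithm series, summed over its largest index `n₁`
(for `|z_i| = 1` and `s₁ = 1` the convergence is only conditional). -/
def Converges {k : ℕ} (s : Fin k → ℕ) (z : Fin k → ℂ) : Prop :=
  ∃ L : ℂ, Tendsto (partialSum s z) atTop (𝓝 L)

/-- The multiple polylogarithm value
`Li_{s₁,…,s_k}(z₁,…,z_k) = ∑_{n₁ > ⋯ > n_k ≥ 1} z₁^{n₁} ⋯ z_k^{n_k} / (n₁^{s₁} ⋯ n_k^{s_k})`. -/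
noncomputable def Li {k : ℕ} (s : Fin k → ℕ) (z : Fin k → ℂ) : ℂ :=
  limUnder atTop (partialSum s z)

open scoped Classical in
/-- The pairs `(φ, ψ)` of order preserving injections `φ : [k] → [k+ℓ]`, `ψ : [ℓ] → [k+ℓ]` whose
images are disjoint with union `[k+ℓ]`. All index sets start at `0` here. -/
noncomputable def shuffles (k l : ℕ) :
    Finset ((Fin k → Fin (k + l)) × (Fin l → Fin (k + l))) :=
  Finset.univ.filter fun p =>
    StrictMono p.1 ∧ StrictMono p.2 ∧
      Disjoint (Set.range p.1) (Set.range p.2) ∧ Set.range p.1 ∪ Set.range p.2 = Set.univ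

/-- The vectors `t` of positive integers of length `m` with `t₁ + ⋯ + t_m = n`. -/
def compositions (m n : ℕ) : Finset (Fin m → ℕ) :=
  (Finset.piAntidiag Finset.univ n).filter fun t => ∀ i, 1 ≤ t i

/-- `i` is in the image of `φ`. -/
def InIm {k n : ℕ} (φ : Fin k → Fin n) (i : Fin n) : Prop := ∃ j, φ j = i

/-- `i - 1` is an index and is in the image of `φ`. -/
def PredInIm {k n : ℕ} (φ : Fin k → Fin n) (i : Fin n) : Prop := ∃ j, (φ j : ℕ) + 1 = i

/-- `h_i = r_j` if `i = φ(j)` and `h_i = s_j` if `i = ψ(j)`, in the form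
`r_{φ⁻¹(i)} s_{ψ⁻¹(i)}` where an empty index stands for the factor `1`. -/
def h {k l : ℕ} (r : Fin k → ℕ) (s : Fin l → ℕ)
    (φ : Fin k → Fin (k + l)) (ψ : Fin l → Fin (k + l)) (i : Fin (k + l)) : ℕ :=
  (∏ j ∈ Finset.univ.filter (fun j => φ j = i), r j) *
    ∏ j ∈ Finset.univ.filter (fun j => ψ j = i), s j

/-- The binomial coefficient with an integer lower entry; it is `0` if that entry is negative. -/
def binom (n : ℕ) (m : ℤ) : ℕ := if 0 ≤ m then n.choose m.toNat else 0

open scoped Classical in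
/-- The coefficient `c_{r,s}^{t,(φ,ψ)}(i)`. -/
noncomputable def c {k l : ℕ} (r : Fin k → ℕ) (s : Fin l → ℕ) (t : Fin (k + l) → ℕ)
    (φ : Fin k → Fin (k + l)) (ψ : Fin l → Fin (k + l)) (i : Fin (k + l)) : ℕ :=
  if (i : ℕ) = 0 ∨ (PredInIm φ i ∧ InIm φ i) ∨ (PredInIm ψ i ∧ InIm ψ i) then
    binom (t i - 1) ((h r s φ ψ i : ℤ) - 1)
  else
    binom (t i - 1) ((∑ j ∈ Finset.Iic i, (t j : ℤ)) - ∑ j ∈ Finset.Iic i, (h r s φ ψ j : ℤ))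

open scoped Classical in
/-- The vector `w ⧢'_{(φ,ψ)} z`. Its `i`-th entry is
`w_j` if `i = φ(j)` and either `i` is the first index or `i - 1 ∈ im φ`;
`z_j` if `i = ψ(j)` and either `i` is the first index or `i - 1 ∈ im ψ`;
`w_1 ⋯ w_j / (z_1 ⋯ z_{i-j})` if `i = φ(j)` and `i - 1 ∈ im ψ`;
`z_1 ⋯ z_j / (w_1 ⋯ w_{i-j})` if `i = ψ(j)` and `i - 1 ∈ im φ`.
The last branch does not occur for a shuffle `(φ, ψ)`. The difference `i - j` is the same for
indices starting at `0` as for indices starting at `1`. -/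
noncomputable def primedShuffle {G : Type*} [CommGroup G] {k l : ℕ}
    (φ : Fin k → Fin (k + l)) (ψ : Fin l → Fin (k + l))
    (w : Fin k → G) (z : Fin l → G) (i : Fin (k + l)) : G :=
  if hi : InIm φ i then
    if (i : ℕ) = 0 ∨ PredInIm φ i then w hi.choose
    else (∏ m ∈ Finset.Iic hi.choose, w m) /
      ∏ m ∈ Finset.univ.filter (fun m : Fin l => (m : ℕ) < (i : ℕ) - (hi.choose : ℕ)), z m
  else if hi : InIm ψ i then
    if (i : ℕ) = 0 ∨ PredInIm ψ i then z hi.choose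
    else (∏ m ∈ Finset.Iic hi.choose, z m) /
      ∏ m ∈ Finset.univ.filter (fun m : Fin k => (m : ℕ) < (i : ℕ) - (hi.choose : ℕ)), w m
  else 1

end MPL

/-! For |x| < 1 consider the power series whose N-th coefficient `term` collects all summands with
n₁ = N. The coefficients are bounded, so two such series multiply by the Cauchy product. The formula
is proved coefficient by coefficient, and then x tends to 1 from below by Abel's theorem. Passing
through power series avoids rearranging series that may converge only conditionally.

The coefficient identity rests on partial fractions. If a + b = N are the leading indices of the two
factors, then 1/(a^r b^s) is a combination of terms 1/(N^t b^(r+s-t)) and 1/(N^t a^(r+s-t)).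
Correspondingly w^a z^b = w^N (z/w)^b = z^N (w/z)^a. Each term splits off N as the leading index of
a new series and leaves a convolution of total depth one less, in which the head of one factor has
changed (`sum_antidiagonal_term_mul_term_succ`). Iterating gives a sum over words recording which
factor lost its head (`sum_antidiagonal_term_mul_term`).

Unrolling the recursion gives the closed form: the altered head carries the accumulated sum of h
minus sum of t, and a quotient of partial products of w and z. These become visible exactly where
the word changes letter (`coef_eq_prod`, `vec_eq_vecEntry`). Convergence comes from summation by
parts (`exists_tendsto_sum_term`); a nonzero coefficient excludes a leading pair (1, 1) on the
right-hand side (`converges_primedShuffle`). -/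

namespace MPL

/-! ### Coefficients by largest index -/

/-- The part of the multiple polylogarithm series with largest index `n₁ = N`
(for the empty series: with total index `0`). -/
noncomputable def term : {k : ℕ} → (Fin k → ℕ) → (Fin k → ℂ) → ℕ → ℂ
  | 0, _, _, N => if N = 0 then 1 else 0
  | _ + 1, s, z, N =>
      z 0 ^ N / (N : ℂ) ^ s 0 * ∑ m ∈ Finset.range N, term (Fin.tail s) (Fin.tail z) m

theorem term_succ_eq {k : ℕ} (s : Fin (k + 1) → ℕ) (z : Fin (k + 1) → ℂ) (N : ℕ) :
    term s z N =
      z 0 ^ N / (N : ℂ) ^ s 0 * ∑ m ∈ Finset.range N, term (Fin.tail s) (Fin.tail z) m := rfl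

theorem term_succ_zero {k : ℕ} (s : Fin (k + 1) → ℕ) (z : Fin (k + 1) → ℂ) :
    term s z 0 = 0 := by
  simp [term]

/-- Splitting off the largest index m leaves a strictly decreasing tuple bounded by m - 1. -/
theorem partialSum_succ {k : ℕ} (s : Fin (k + 1) → ℕ) (z : Fin (k + 1) → ℂ) (N : ℕ) :
    partialSum s z N =
      ∑ m ∈ Finset.Icc 1 N, z 0 ^ m / (m : ℂ) ^ s 0 *
        partialSum (Fin.tail s) (Fin.tail z) (m - 1) := by
  unfold partialSum
  simp_rw [Finset.mul_sum]
  rw [Finset.sum_sigma']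
  refine Finset.sum_bij' (fun n _ => ⟨n 0, Fin.tail n⟩) (fun x _ => Fin.cons x.1 x.2)
    ?_ ?_ ?_ ?_ ?_
  · intro n hn
    simp only [Finset.mem_filter, Fintype.mem_piFinset, Finset.mem_Icc, Finset.mem_sigma] at hn ⊢
    refine ⟨hn.1 0, fun i => ⟨(hn.1 _).1, ?_⟩, fun i j hij => hn.2 _ _ (Fin.succ_lt_succ_iff.2 hij)⟩
    have := hn.2 0 i.succ (Fin.succ_pos i)
    show n i.succ ≤ n 0 - 1
    omega
  · rintro ⟨m, n⟩ hn
    simp only [Finset.mem_filter, Fintype.mem_piFinset, Finset.mem_Icc, Finset.mem_sigma] at hn ⊢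
    refine ⟨fun i => ?_, fun i j hij => ?_⟩
    · refine Fin.cases ?_ (fun i => ?_) i
      · simpa using hn.1
      · have := hn.2.1 i
        simp only [Fin.cons_succ]
        omega
    · induction i using Fin.cases with
      | zero =>
        induction j using Fin.cases with
        | zero => simp at hij
        | succ j =>
          have := hn.2.1 j
          simp only [Fin.cons_succ, Fin.cons_zero]
          omega
      | succ i =>
        induction j using Fin.cases with
        | zero => simp at hij
        | succ j =>
          simpa using hn.2.2 i j (Fin.succ_lt_succ_iff.1 hij)
  · intro n _
    simp
  · rintro ⟨m, n⟩ _
    simp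
  · intro n _
    rw [Fin.prod_univ_succ]
    rfl

theorem partialSum_eq_sum_term {k : ℕ} (s : Fin k → ℕ) (z : Fin k → ℂ) (N : ℕ) :
    partialSum s z N = ∑ m ∈ Finset.range (N + 1), term s z m := by
  induction k generalizing N with
  | zero => simp [partialSum, term]
  | succ k ih =>
    rw [partialSum_succ, Finset.sum_range_succ', term_succ_zero, add_zero,
      Finset.range_eq_Ico, Finset.sum_Ico_add' (fun m => term s z m) 0 N 1]
    refine Finset.sum_congr rfl fun m hm => ?_
    rw [ih, term_succ_eq]
    rw [Finset.mem_Ico] at hm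
    rw [Nat.sub_add_cancel (by omega)]

/-! ### Growth bounds, convergence and Abel's theorem -/

theorem sum_inv_sqrt_le (N : ℕ) :
    ∑ m ∈ Finset.range (N + 1), (√(m : ℝ))⁻¹ ≤ 2 * √(N : ℝ) := by
  induction N with
  | zero => simp
  | succ N ih =>
    rw [Finset.sum_range_succ]
    have h1 : 0 < √((N + 1 : ℕ) : ℝ) := Real.sqrt_pos.2 (by positivity)
    have h2 : √((N + 1 : ℕ) : ℝ) ^ 2 = N + 1 := by
      rw [Real.sq_sqrt (by positivity)]; push_cast; ring
    have h3 : √(N : ℝ) ^ 2 = N := Real.sq_sqrt (by positivity)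
    set a := √((N + 1 : ℕ) : ℝ)
    set b := √(N : ℝ)
    -- Since a² - b² = 1, the difference 2a(a - b) - 1 equals (a - b)².
    have h4 : a⁻¹ ≤ 2 * a - 2 * b := by
      rw [inv_le_iff_one_le_mul₀ h1]
      nlinarith [sq_nonneg (a - b)]
    linarith

section Bounds

variable {k : ℕ}

/-- The square root is a crude substitute for powers of log N that reproduces itself: a tail sum
O(√N) divided by N is O(1/√N), which sums to O(√N) again at the cost of a factor 2. The pointwise
bound fails for k = 0 at N = 0, where the coefficient is 1 and the inverse of 0 is 0. -/
theorem sum_norm_term_le (s : Fin k → ℕ) (z : Fin k → ℂ) (hs : ∀ i, 1 ≤ s i)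
    (hz : ∀ i, ‖z i‖ = 1) (N : ℕ) :
    ∑ m ∈ Finset.range N, ‖term s z m‖ ≤ 2 ^ k * √(N : ℝ) ∧
      (k ≠ 0 → ‖term s z N‖ ≤ 2 ^ k * (√(N : ℝ))⁻¹) := by
  induction k generalizing N with
  | zero =>
    refine ⟨?_, fun h => absurd rfl h⟩
    rcases Nat.eq_zero_or_pos N with rfl | hN
    · simp
    · have h1 : (1 : ℝ) ≤ √(N : ℝ) := by
        rw [Real.one_le_sqrt]; exact_mod_cast hN
      have h2 : ∑ m ∈ Finset.range N, ‖term s z m‖ = 1 := by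
        rw [Finset.sum_eq_single_of_mem 0 (Finset.mem_range.2 hN)]
        · simp [term]
        · intro b _ hb
          simp [term, hb]
      rw [h2]; simpa using h1
  | succ k ih =>
    -- The constant here is 2^k, not 2^(k+1); summation uses up the remaining factor 2.
    have key : ∀ N : ℕ, ‖term s z N‖ ≤ 2 ^ k * (√(N : ℝ))⁻¹ := by
      intro N
      rcases Nat.eq_zero_or_pos N with rfl | hN
      · simp [term_succ_zero]
      have hN' : (1 : ℝ) ≤ N := by exact_mod_cast hN
      have h1 := (ih (Fin.tail s) (Fin.tail z) (fun i => hs _) (fun i => hz _) N).1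
      rw [term_succ_eq, norm_mul, norm_div, norm_pow, norm_pow, hz, one_pow, Complex.norm_natCast]
      have h2 : (1 : ℝ) / (N : ℝ) ^ s 0 ≤ (N : ℝ)⁻¹ := by
        rw [one_div]
        exact inv_anti₀ (by linarith) (le_self_pow₀ hN' (by have := hs 0; omega))
      have h3 : (N : ℝ)⁻¹ * √(N : ℝ) = (√(N : ℝ))⁻¹ := by
        have h4 : 0 < √(N : ℝ) := Real.sqrt_pos.2 (by linarith)
        have h5 : (N : ℝ) = √(N : ℝ) * √(N : ℝ) := (Real.mul_self_sqrt (by linarith)).symm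
        nth_rewrite 1 [h5]
        field_simp
      calc _ ≤ (N : ℝ)⁻¹ * (2 ^ k * √(N : ℝ)) :=
            mul_le_mul h2 ((norm_sum_le _ _).trans h1) (norm_nonneg _) (by positivity)
        _ = 2 ^ k * (√(N : ℝ))⁻¹ := by rw [← h3]; ring
    refine ⟨?_, fun _ => (key N).trans ?_⟩
    · rcases N with _ | N
      · simp
      calc _ ≤ ∑ m ∈ Finset.range (N + 1), 2 ^ k * (√(m : ℝ))⁻¹ :=
            Finset.sum_le_sum fun m _ => key m
        _ = 2 ^ k * ∑ m ∈ Finset.range (N + 1), (√(m : ℝ))⁻¹ := by rw [Finset.mul_sum]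
        _ ≤ 2 ^ k * (2 * √(N : ℝ)) := by
            gcongr; exact sum_inv_sqrt_le N
        _ ≤ 2 ^ k * (2 * √((N + 1 : ℕ) : ℝ)) := by gcongr; omega
        _ = _ := by ring
    · rw [pow_succ]
      have : (0 : ℝ) ≤ 2 ^ k * (√(N : ℝ))⁻¹ := by positivity
      nlinarith

theorem norm_term_le (s : Fin k → ℕ) (z : Fin k → ℂ) (hs : ∀ i, 1 ≤ s i)
    (hz : ∀ i, ‖z i‖ = 1) (N : ℕ) (hN : N ≠ 0) : ‖term s z N‖ ≤ 2 ^ k * (√(N : ℝ))⁻¹ := by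
  rcases Nat.eq_zero_or_pos k with rfl | hk
  · simp [term, hN]
  · exact (sum_norm_term_le s z hs hz N).2 hk.ne'

theorem norm_term_le_two_pow (s : Fin k → ℕ) (z : Fin k → ℂ) (hs : ∀ i, 1 ≤ s i)
    (hz : ∀ i, ‖z i‖ = 1) (N : ℕ) : ‖term s z N‖ ≤ 2 ^ k := by
  rcases Nat.eq_zero_or_pos N with rfl | hN
  · cases k <;> simp [term]
  · refine (norm_term_le s z hs hz N hN.ne').trans ?_
    refine mul_le_of_le_one_right (by positivity) (inv_le_one_of_one_le₀ ?_)
    rw [Real.one_le_sqrt]; exact_mod_cast hN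

theorem summable_norm_term_mul_pow (s : Fin k → ℕ) (z : Fin k → ℂ) (hs : ∀ i, 1 ≤ s i)
    (hz : ∀ i, ‖z i‖ = 1) {x : ℂ} (hx : ‖x‖ < 1) : Summable fun n => ‖term s z n * x ^ n‖ := by
  refine Summable.of_nonneg_of_le (fun _ => norm_nonneg _) (fun n => ?_)
    ((summable_geometric_of_lt_one (norm_nonneg x) hx).mul_left (2 ^ k))
  rw [norm_mul, norm_pow]
  gcongr
  exact norm_term_le_two_pow s z hs hz n

theorem inv_mul_inv_sqrt (n : ℕ) :
    ((n : ℝ) * √(n : ℝ))⁻¹ = 1 / (n : ℝ) ^ (3 / 2 : ℝ) := by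
  rcases Nat.eq_zero_or_pos n with rfl | hn
  · norm_num
  rw [one_div, Real.sqrt_eq_rpow, show (3 / 2 : ℝ) = 1 + 1 / 2 by norm_num,
    Real.rpow_add (by exact_mod_cast hn), Real.rpow_one]

theorem summable_inv_mul_inv_sqrt : Summable fun n : ℕ => ((n : ℝ) * √(n : ℝ))⁻¹ := by
  simp_rw [inv_mul_inv_sqrt]
  exact Real.summable_one_div_nat_rpow.2 (by norm_num)

/-- Summation by parts: a power series whose coefficients tend to `0` and have bounded variation
converges at every `z ≠ 1` on the unit circle. -/
theorem exists_tendsto_sum_pow_mul {z : ℂ} (hz : ‖z‖ = 1) (hz1 : z ≠ 1) {u : ℕ → ℂ}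
    (hu : Tendsto u atTop (𝓝 0)) (hv : Summable fun n => ‖u (n + 1) - u n‖) :
    ∃ L, Tendsto (fun N => ∑ n ∈ Finset.range N, z ^ n * u n) atTop (𝓝 L) := by
  -- Multiplying by 1 - z telescopes the sum up to the differences of u, which is where z ≠ 1
  -- enters.
  have hid : ∀ N, ∑ n ∈ Finset.range N, z ^ n * u n =
      (1 - z)⁻¹ * (∑ n ∈ Finset.range N, z ^ (n + 1) * (u (n + 1) - u n) + u 0 - z ^ N * u N) := by
    intro N
    have h1 : (1 - z) ≠ 0 := sub_ne_zero.2 hz1.symm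
    rw [eq_inv_mul_iff_mul_eq₀ h1]
    induction N with
    | zero => simp
    | succ N ih =>
      rw [Finset.sum_range_succ, Finset.sum_range_succ, mul_add, ih]
      ring
  have h1 : Summable fun n => z ^ (n + 1) * (u (n + 1) - u n) := by
    refine Summable.of_norm ?_
    simpa [norm_mul, hz] using hv
  have h2 : Tendsto (fun N => z ^ N * u N) atTop (𝓝 0) := by
    rw [tendsto_zero_iff_norm_tendsto_zero]
    simpa [norm_mul, hz] using (tendsto_zero_iff_norm_tendsto_zero.1 hu)
  simp_rw [hid]
  exact ⟨_, (((h1.hasSum.tendsto_sum_nat.add_const (u 0)).sub h2).const_mul _)⟩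

/-- For a leading exponent at least 2 the coefficients are O(n^(-3/2)) and convergence is absolute.
For leading exponent 1, summation by parts applies to P(n)/n, with P(n) the tail sum, which tends to
0 with differences O(n^(-3/2)). -/
theorem exists_tendsto_sum_term (s : Fin (k + 1) → ℕ) (z : Fin (k + 1) → ℂ) (hs : ∀ i, 1 ≤ s i)
    (hz : ∀ i, ‖z i‖ = 1) (h0 : s 0 = 1 → z 0 ≠ 1) :
    ∃ L, Tendsto (fun N => ∑ n ∈ Finset.range N, term s z n) atTop (𝓝 L) := by
  have hP : ∀ N, ‖∑ m ∈ Finset.range N, term (Fin.tail s) (Fin.tail z) m‖ ≤ 2 ^ k * √(N : ℝ) :=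
    fun N => (norm_sum_le _ _).trans
      (sum_norm_term_le (Fin.tail s) (Fin.tail z) (fun i => hs _) (fun i => hz _) N).1
  by_cases h1 : s 0 = 1
  · set P : ℕ → ℂ := fun N => ∑ m ∈ Finset.range N, term (Fin.tail s) (Fin.tail z) m with hPdef
    have hbound : ∀ n : ℕ, ‖P n‖ / n ≤ 2 ^ k * (√(n : ℝ))⁻¹ := by
      intro n
      rcases Nat.eq_zero_or_pos n with rfl | hn
      · simp
      have hn' : (0 : ℝ) < n := by exact_mod_cast hn
      rw [div_le_iff₀ hn', mul_assoc, inv_mul_eq_div, Real.div_sqrt]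
      exact hP n
    have := exists_tendsto_sum_pow_mul (hz 0) (h0 h1) (u := fun n => P n / n) ?_ ?_
    · obtain ⟨L, hL⟩ := this
      refine ⟨L, hL.congr fun N => Finset.sum_congr rfl fun n _ => ?_⟩
      rw [term_succ_eq, h1, pow_one]
      ring
    · refine squeeze_zero_norm (a := fun n : ℕ => 2 ^ k * (√(n : ℝ))⁻¹) (fun n => ?_) ?_
      · rw [norm_div, Complex.norm_natCast]
        exact hbound n
      · rw [← mul_zero ((2 : ℝ) ^ k)]
        exact ((Real.tendsto_sqrt_atTop.comp tendsto_natCast_atTop_atTop).inv_tendsto_atTop).const_mul _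
    · refine Summable.of_norm_bounded_eventually_nat
        (g := fun n : ℕ => 2 ^ k * 2 * ((n : ℝ) * √(n : ℝ))⁻¹)
        (summable_inv_mul_inv_sqrt.mul_left _) ?_
      filter_upwards [eventually_gt_atTop 0] with n hn
      have hn' : (0 : ℝ) < n := by exact_mod_cast hn
      have hnc : (n : ℂ) ≠ 0 := by exact_mod_cast hn.ne'
      have hnc' : (n : ℂ) + 1 ≠ 0 := by exact_mod_cast n.succ_ne_zero
      -- Both the new tail coefficient and the mean P(n)/n are O(1/√n), so division by n + 1 gains
      -- the missing power.
      have e : P (n + 1) / ((n + 1 : ℕ) : ℂ) - P n / n =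
          (term (Fin.tail s) (Fin.tail z) n - P n / n) / ((n + 1 : ℕ) : ℂ) := by
        simp only [hPdef, Finset.sum_range_succ]
        push_cast
        field_simp
        ring
      rw [norm_norm, e, norm_div, Complex.norm_natCast]
      have h2 := norm_term_le (Fin.tail s) (Fin.tail z) (fun i => hs _) (fun i => hz _) n hn.ne'
      have h3 : ‖term (Fin.tail s) (Fin.tail z) n - P n / n‖ ≤ 2 ^ k * 2 * (√(n : ℝ))⁻¹ := by
        refine (norm_sub_le _ _).trans ?_
        rw [norm_div, Complex.norm_natCast]
        linarith [hbound n]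
      calc _ ≤ 2 ^ k * 2 * (√(n : ℝ))⁻¹ / n := by
            gcongr
            linarith
        _ = _ := by rw [mul_inv]; ring
  · have h2 : Summable (term s z) := by
      refine Summable.of_norm_bounded_eventually_nat
        (g := fun n : ℕ => 2 ^ k * ((n : ℝ) * √(n : ℝ))⁻¹)
        (summable_inv_mul_inv_sqrt.mul_left _) ?_
      filter_upwards [eventually_gt_atTop 0] with n hn
      have hn' : (1 : ℝ) ≤ n := by exact_mod_cast hn
      have hn0 : (0 : ℝ) < n := by linarith
      rw [term_succ_eq, norm_mul, norm_div, norm_pow, norm_pow, hz, one_pow, Complex.norm_natCast]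
      have h3 : (1 : ℝ) / (n : ℝ) ^ s 0 ≤ 1 / (n : ℝ) ^ 2 := by
        have := hs 0
        gcongr
        omega
      calc _ ≤ 1 / (n : ℝ) ^ 2 * (2 ^ k * √(n : ℝ)) :=
            mul_le_mul h3 (hP n) (norm_nonneg _) (by positivity)
        _ = _ := by
          have h4 : 0 < √(n : ℝ) := Real.sqrt_pos.2 hn0
          have h5 : √(n : ℝ) ^ 2 = n := Real.sq_sqrt hn0.le
          field_simp
          rw [h5]
    exact ⟨_, h2.hasSum.tendsto_sum_nat⟩

theorem tendsto_partialSum_iff (s : Fin k → ℕ) (z : Fin k → ℂ) (L : ℂ) :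
    Tendsto (partialSum s z) atTop (𝓝 L) ↔
      Tendsto (fun N => ∑ n ∈ Finset.range N, term s z n) atTop (𝓝 L) := by
  rw [← tendsto_add_atTop_iff_nat (f := fun N => ∑ n ∈ Finset.range N, term s z n) 1]
  exact tendsto_congr (partialSum_eq_sum_term s z)

theorem converges_of_ne_one (s : Fin k → ℕ) (z : Fin k → ℂ) (hk : 0 < k) (hs : ∀ i, 1 ≤ s i)
    (hz : ∀ i, ‖z i‖ = 1) (h0 : s ⟨0, hk⟩ = 1 → z ⟨0, hk⟩ ≠ 1) : Converges s z := by
  obtain ⟨k, rfl⟩ := Nat.exists_eq_succ_of_ne_zero hk.ne'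
  obtain ⟨L, hL⟩ := exists_tendsto_sum_term s z hs hz h0
  exact ⟨L, (tendsto_partialSum_iff s z L).2 hL⟩

/-- Abel's limit theorem for multiple polylogarithms. -/
theorem Converges.tendsto_tsum {s : Fin k → ℕ} {z : Fin k → ℂ} (h : Converges s z) :
    Tendsto (fun x : ℂ => ∑' n, term s z n * x ^ n) ((𝓝[<] (1 : ℝ)).map Complex.ofReal)
      (𝓝 (Li s z)) :=
  Complex.tendsto_tsum_powerSeries_nhdsWithin_lt
    ((tendsto_partialSum_iff s z _).1 (tendsto_nhds_limUnder h))

end Bounds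

/-! ### Partial fractions -/

section PartialFractions

/-- The binomial coefficient `binom (t - 1) (h - 1)`, written so that it vanishes for `h ≤ 0`. -/
def weight (t : ℕ) (h : ℤ) : ℕ := binom (t - 1) (t - h)

theorem weight_eq_choose {t h : ℕ} (ht : 1 ≤ t) (hh : 1 ≤ h) :
    weight t h = (t - 1).choose (h - 1) := by
  unfold weight binom
  split_ifs with h0
  · have h1 : h ≤ t := by omega
    have h2 : ((t : ℤ) - h).toNat = (t - 1) - (h - 1) := by omega
    rw [h2, Nat.choose_symm (by omega)]
  · rw [Nat.choose_eq_zero_of_lt (by omega)]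

theorem weight_of_lt {t : ℕ} {h : ℤ} (ht : (t : ℤ) < h) : weight t h = 0 := by
  unfold weight binom
  rw [if_neg (by omega)]

/-- This is why the lower entry is t - h and not h - 1: for h ≤ 0 it exceeds t - 1. Exponents may
then drop to 0 or below in ℤ, and the coefficient vanishes by itself. -/
theorem weight_of_nonpos {t : ℕ} {h : ℤ} (ht : 1 ≤ t) (hh : h ≤ 0) : weight t h = 0 := by
  unfold weight binom
  rw [if_pos (by omega), Nat.choose_eq_zero_of_lt (by omega)]

variable {R : Type*} [CommRing R]

/-- One half of the partial fraction expansion of `X ^ (p + 1) * Y ^ (q + 1)`. -/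
def partialFraction (T Y : R) (p q : ℕ) : R :=
  ∑ t ∈ Finset.range (p + q + 1), (t.choose p : R) * T ^ (t + 1) * Y ^ (p + q + 1 - t)

/-- Pascal's rule applied to each coefficient. -/
theorem partialFraction_succ_succ (T Y : R) (p q : ℕ) :
    partialFraction T Y (p + 1) (q + 1) =
      T * (partialFraction T Y p (q + 1) + partialFraction T Y (p + 1) q) := by
  unfold partialFraction
  rw [Finset.sum_range_succ', show p + 1 + q + 1 = p + (q + 1) + 1 by ring, ← Finset.sum_add_distrib,
    Finset.mul_sum]
  simp only [Nat.choose_zero_succ, Nat.cast_zero, zero_mul, add_zero]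
  refine Finset.sum_congr (by congr 1; ring) fun t _ => ?_
  rw [Nat.choose_succ_succ, show p + 1 + (q + 1) + 1 - (t + 1) = p + (q + 1) + 1 - t by omega]
  push_cast
  ring

theorem partialFraction_zero_succ (T Y : R) (q : ℕ) :
    partialFraction T Y 0 (q + 1) = T * (Y ^ (q + 2) + partialFraction T Y 0 q) := by
  unfold partialFraction
  rw [Finset.sum_range_succ', mul_add, Finset.mul_sum, add_comm]
  congr 1
  · simp
  · refine Finset.sum_congr (by congr 1) fun t _ => ?_
    rw [show 0 + (q + 1) + 1 - (t + 1) = 0 + q + 1 - t by omega]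
    simp only [Nat.choose_zero_right]
    ring

theorem partialFraction_zero_right (T Y : R) (p : ℕ) :
    partialFraction T Y p 0 = T ^ (p + 1) * Y := by
  unfold partialFraction
  rw [Finset.sum_range_succ, Finset.sum_eq_zero]
  · simp
  · intro t ht
    rw [Nat.choose_eq_zero_of_lt (by simpa using ht)]
    simp

/-- One use of the relation replaces a factor XY by T(X + Y), lowering one of the two exponents;
both sides obey this same Pascal-type recursion, with the cases p = 0 and q = 0 as boundary. -/
theorem pow_mul_pow_eq_partialFraction {X Y T : R} (h : X * Y = T * (X + Y)) (p q : ℕ) :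
    X ^ (p + 1) * Y ^ (q + 1) = partialFraction T Y p q + partialFraction T X q p := by
  induction p generalizing q with
  | zero =>
    induction q with
    | zero => simp only [partialFraction_zero_right]; linear_combination h
    | succ q ih =>
      rw [partialFraction_zero_succ, partialFraction_zero_right]
      rw [partialFraction_zero_right] at ih
      linear_combination T * ih + Y ^ (q + 1) * h
  | succ p ihp =>
    induction q with
    | zero =>
      have := ihp 0
      rw [partialFraction_zero_succ, partialFraction_zero_right]
      rw [partialFraction_zero_right] at this
      linear_combination T * this + X ^ (p + 1) * h
    | succ q ihq =>
      rw [partialFraction_succ_succ, partialFraction_succ_succ]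
      linear_combination T * ihp (q + 1) + T * ihq + X ^ (p + 1) * Y ^ (q + 1) * h

theorem partialFraction_eq_sum_Ico (T Y : R) {r s : ℕ} (hr : 1 ≤ r) (hs : 1 ≤ s) :
    partialFraction T Y (r - 1) (s - 1) =
      ∑ t ∈ Finset.Ico 1 (r + s), (weight t r : R) * T ^ t * Y ^ (r + s - t) := by
  unfold partialFraction
  rw [Finset.range_eq_Ico, Finset.sum_Ico_eq_sum_range, Finset.sum_Ico_eq_sum_range]
  refine Finset.sum_congr (by congr 1; omega) fun t _ => ?_
  rw [weight_eq_choose (by omega) hr]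
  congr 2
  · congr 2
    omega
  · congr 1
    omega
  · omega

/-- The partial fraction expansion of `1 / (a ^ r * b ^ s)`. -/
theorem one_div_pow_mul_one_div_pow {a b : ℕ} (ha : 0 < a) (hb : 0 < b) {r s : ℕ}
    (hr : 1 ≤ r) (hs : 1 ≤ s) :
    1 / (a : ℂ) ^ r * (1 / (b : ℂ) ^ s) = ∑ t ∈ Finset.Ico 1 (r + s),
      ((weight t r : ℂ) * (1 / ((a + b : ℕ) : ℂ) ^ t) * (1 / (b : ℂ) ^ (r + s - t)) +
        (weight t s : ℂ) * (1 / ((a + b : ℕ) : ℂ) ^ t) * (1 / (a : ℂ) ^ (r + s - t))) := by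
  have ha' : (a : ℂ) ≠ 0 := by exact_mod_cast ha.ne'
  have hb' : (b : ℂ) ≠ 0 := by exact_mod_cast hb.ne'
  have hab : (a : ℂ) + b ≠ 0 := by exact_mod_cast (by omega : a + b ≠ 0)
  -- The relation XY = T(X + Y) for X = 1/a, Y = 1/b and T = 1/(a + b).
  have h : (a : ℂ)⁻¹ * (b : ℂ)⁻¹ = ((a + b : ℕ) : ℂ)⁻¹ * ((a : ℂ)⁻¹ + (b : ℂ)⁻¹) := by
    push_cast
    field_simp
    ring
  have := pow_mul_pow_eq_partialFraction h (r - 1) (s - 1)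
  rw [Nat.sub_add_cancel hr, Nat.sub_add_cancel hs, partialFraction_eq_sum_Ico _ _ hr hs,
    partialFraction_eq_sum_Ico _ _ hs hr, add_comm s r, ← Finset.sum_add_distrib] at this
  simpa only [one_div, inv_pow] using this

end PartialFractions

/-! ### Recursion for the convolution of two coefficient sequences -/

section Recursion

/-- Both sides sum f(m) g(b) over all m + b < N: given such m and b, the index a = N - b is
determined and exceeds m. -/
theorem sum_antidiagonal_sum_range_mul {R : Type*} [CommSemiring R] (f g : ℕ → R) (N : ℕ) :
    ∑ p ∈ Finset.HasAntidiagonal.antidiagonal N, (∑ m ∈ Finset.range p.1, f m) * g p.2 =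
      ∑ m ∈ Finset.range N, ∑ p ∈ Finset.HasAntidiagonal.antidiagonal m, f p.1 * g p.2 := by
  induction N with
  | zero => simp
  | succ N ih =>
    rw [Finset.sum_range_succ, ← ih, Finset.Nat.sum_antidiagonal_succ]
    simp [Finset.sum_range_succ, add_mul, Finset.sum_add_distrib]

theorem sum_antidiagonal_mul_sum_range {R : Type*} [CommSemiring R] (f g : ℕ → R) (N : ℕ) :
    ∑ p ∈ Finset.HasAntidiagonal.antidiagonal N, f p.1 * ∑ m ∈ Finset.range p.2, g m =
      ∑ m ∈ Finset.range N, ∑ p ∈ Finset.HasAntidiagonal.antidiagonal m, f p.1 * g p.2 := by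
  rw [← Finset.Nat.sum_antidiagonal_swap]
  simp only [Prod.fst_swap, Prod.snd_swap]
  simp_rw [mul_comm (f _)]
  rw [sum_antidiagonal_sum_range_mul g f]
  refine Finset.sum_congr rfl fun m _ => ?_
  rw [← Finset.Nat.sum_antidiagonal_swap]
  rfl

/-- Partial fractions remove one of the leading indices a, b from the denominator, and the powers of
the arguments are regrouped to match. The removed index then only bounds the tail of its factor, so
the sum becomes a convolution over smaller totals m < N. -/
theorem sum_antidiagonal_term_mul_term_succ {k l : ℕ} (r : Fin (k + 1) → ℕ) (s : Fin (l + 1) → ℕ)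
    (w : Fin (k + 1) → ℂ) (z : Fin (l + 1) → ℂ) (hr : 1 ≤ r 0) (hs : 1 ≤ s 0)
    (hw : w 0 ≠ 0) (hz : z 0 ≠ 0) (N : ℕ) :
    ∑ p ∈ Finset.HasAntidiagonal.antidiagonal N, term r w p.1 * term s z p.2 =
      ∑ t ∈ Finset.Ico 1 (r 0 + s 0),
        ((weight t (r 0) : ℂ) * (w 0 ^ N / (N : ℂ) ^ t * ∑ m ∈ Finset.range N,
            ∑ p ∈ Finset.HasAntidiagonal.antidiagonal m, term (Fin.tail r) (Fin.tail w) p.1 *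
              term (Fin.cons (r 0 + s 0 - t) (Fin.tail s) : Fin (l + 1) → ℕ)
                (Fin.cons (z 0 / w 0) (Fin.tail z) : Fin (l + 1) → ℂ) p.2) +
          (weight t (s 0) : ℂ) * (z 0 ^ N / (N : ℂ) ^ t * ∑ m ∈ Finset.range N,
            ∑ p ∈ Finset.HasAntidiagonal.antidiagonal m,
              term (Fin.cons (r 0 + s 0 - t) (Fin.tail r) : Fin (k + 1) → ℕ)
                (Fin.cons (w 0 / z 0) (Fin.tail w) : Fin (k + 1) → ℂ) p.1 *
              term (Fin.tail s) (Fin.tail z) p.2)) := by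
  simp_rw [← sum_antidiagonal_sum_range_mul (term (Fin.tail r) (Fin.tail w)),
    ← sum_antidiagonal_mul_sum_range _ (term (Fin.tail s) (Fin.tail z)), Finset.mul_sum,
    ← Finset.sum_add_distrib]
  rw [Finset.sum_comm]
  refine Finset.sum_congr rfl fun p hp => ?_
  obtain ⟨a, b⟩ := p
  rw [Finset.HasAntidiagonal.mem_antidiagonal] at hp
  simp only at hp ⊢
  simp only [term_succ_eq, Fin.cons_zero, Fin.tail_cons, ← Finset.mul_sum]
  set P := ∑ m ∈ Finset.range a, term (Fin.tail r) (Fin.tail w) m with hP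
  set Q := ∑ m ∈ Finset.range b, term (Fin.tail s) (Fin.tail z) m with hQ
  -- Partial fractions need a, b > 0; otherwise a tail sum is empty and both sides vanish.
  rcases Nat.eq_zero_or_pos a with rfl | ha
  · have : P = 0 := by simp [hP]
    simp [this]
  rcases Nat.eq_zero_or_pos b with rfl | hb
  · have : Q = 0 := by simp [hQ]
    simp [this]
  have e1 : w 0 ^ N * (z 0 / w 0) ^ b = w 0 ^ a * z 0 ^ b := by
    rw [← hp, pow_add, div_pow]
    field_simp
  have e2 : z 0 ^ N * (w 0 / z 0) ^ a = w 0 ^ a * z 0 ^ b := by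
    rw [← hp, pow_add, div_pow]
    field_simp
  calc w 0 ^ a / (a : ℂ) ^ r 0 * P * (z 0 ^ b / (b : ℂ) ^ s 0 * Q)
      = w 0 ^ a * z 0 ^ b * P * Q * (1 / (a : ℂ) ^ r 0 * (1 / (b : ℂ) ^ s 0)) := by ring
    _ = _ := by
      rw [one_div_pow_mul_one_div_pow ha hb hr hs, Finset.mul_sum, hp]
      refine Finset.sum_congr rfl fun t _ => ?_
      rw [mul_add]
      congr 1
      · rw [← e1]; ring
      · rw [← e2]; ring

end Recursion

/-! ### Words, compositions and the recursive coefficients -/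

section Words

/-- The words of length `n` with `k` letters `true`. -/
def words (n k : ℕ) : Finset (Fin n → Bool) :=
  Finset.univ.filter fun e => (Finset.univ.filter fun i => e i = true).card = k

theorem mem_words {n k : ℕ} {e : Fin n → Bool} :
    e ∈ words n k ↔ (Finset.univ.filter fun i => e i = true).card = k := by
  simp [words]

theorem cons_true_mem_words {n k : ℕ} {e : Fin n → Bool} :
    (Fin.cons true e : Fin (n + 1) → Bool) ∈ words (n + 1) (k + 1) ↔ e ∈ words n k := by
  simp [mem_words, Fin.card_filter_univ_succ]

theorem cons_false_mem_words {n k : ℕ} {e : Fin n → Bool} :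
    (Fin.cons false e : Fin (n + 1) → Bool) ∈ words (n + 1) k ↔ e ∈ words n k := by
  simp [mem_words, Fin.card_filter_univ_succ]

theorem sum_words_succ {M : Type*} [AddCommMonoid M] (n k : ℕ) (F : (Fin (n + 1) → Bool) → M) :
    ∑ e ∈ words (n + 1) (k + 1), F e =
      ∑ e ∈ words n k, F (Fin.cons true e) + ∑ e ∈ words n (k + 1), F (Fin.cons false e) := by
  rw [← Finset.sum_filter_add_sum_filter_not _ (fun e : Fin (n + 1) → Bool => e 0 = true)]
  congr 1
  · symm
    refine Finset.sum_bij' (fun e _ => Fin.cons true e) (fun e _ => Fin.tail e) ?_ ?_ ?_ ?_ ?_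
    · intro e he
      exact Finset.mem_filter.2 ⟨cons_true_mem_words.2 he, rfl⟩
    · intro e he
      rw [Finset.mem_filter] at he
      rw [← cons_true_mem_words, ← he.2, Fin.cons_self_tail]
      exact he.1
    · simp
    · intro e he
      rw [← (Finset.mem_filter.1 he).2, Fin.cons_self_tail]
    · simp
  · symm
    refine Finset.sum_bij' (fun e _ => Fin.cons false e) (fun e _ => Fin.tail e) ?_ ?_ ?_ ?_ ?_
    · intro e he
      exact Finset.mem_filter.2 ⟨cons_false_mem_words.2 he, by simp⟩
    · intro e he
      rw [Finset.mem_filter, Bool.not_eq_true] at he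
      rw [← cons_false_mem_words, ← he.2, Fin.cons_self_tail]
      exact he.1
    · simp
    · intro e he
      rw [← Bool.eq_false_of_not_eq_true (Finset.mem_filter.1 he).2, Fin.cons_self_tail]
    · simp

theorem mem_compositions {m n : ℕ} {t : Fin m → ℕ} :
    t ∈ compositions m n ↔ ∑ i, t i = n ∧ ∀ i, 1 ≤ t i := by
  simp [compositions]

theorem sum_compositions_succ {M : Type*} [AddCommMonoid M] (n m : ℕ)
    (F : (Fin (n + 1) → ℕ) → M) :
    ∑ t ∈ compositions (n + 1) m, F t =
      ∑ a ∈ Finset.Icc 1 m, ∑ t ∈ compositions n (m - a), F (Fin.cons a t) := by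
  rw [Finset.sum_sigma']
  refine Finset.sum_bij' (fun t _ => ⟨t 0, Fin.tail t⟩) (fun x _ => Fin.cons x.1 x.2) ?_ ?_ ?_ ?_ ?_
  · intro t ht
    rw [mem_compositions, Fin.sum_univ_succ] at ht
    simp only [Finset.mem_sigma, Finset.mem_Icc, mem_compositions]
    refine ⟨⟨ht.2 0, by omega⟩, ?_, fun i => ht.2 _⟩
    simp only [Fin.tail]
    omega
  · rintro ⟨a, t⟩ hx
    simp only [Finset.mem_sigma, Finset.mem_Icc, mem_compositions] at hx
    rw [mem_compositions, Fin.sum_univ_succ]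
    simp only [Fin.cons_zero, Fin.cons_succ]
    exact ⟨by omega, Fin.cases hx.1.1 hx.2.2⟩
  · simp
  · simp
  · simp

/-- The coefficient of the term belonging to a shuffle, given by the word `e`, and to the exponents
`t` in the product of series with exponents `r` and `s`. -/
def coef : {n : ℕ} → (Fin n → Bool) → (Fin n → ℕ) → (ℕ → ℤ) → (ℕ → ℤ) → ℕ
  | 0, _, _, _, _ => 1
  | _ + 1, e, t, r, s =>
    if e 0 = true then
      weight (t 0) (r 0) * coef (Fin.tail e) (Fin.tail t) (fun i => r (i + 1))
        (Function.update s 0 (r 0 + s 0 - t 0))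
    else
      weight (t 0) (s 0) * coef (Fin.tail e) (Fin.tail t)
        (Function.update r 0 (r 0 + s 0 - t 0)) (fun i => s (i + 1))

/-- The arguments of the term belonging to a shuffle, given by the word `e`, in the product of
series with arguments `w` and `z`. -/
def vec {G : Type*} [CommGroup G] : {n : ℕ} → (Fin n → Bool) → (ℕ → G) → (ℕ → G) → Fin n → G
  | 0, _, _, _ => Fin.elim0
  | n + 1, e, w, z =>
    if e 0 = true then
      (Fin.cons (w 0) (vec (Fin.tail e) (fun i => w (i + 1)) (Function.update z 0 (z 0 / w 0))) :
        Fin (n + 1) → G)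
    else
      (Fin.cons (z 0) (vec (Fin.tail e) (Function.update w 0 (w 0 / z 0)) (fun i => z (i + 1))) :
        Fin (n + 1) → G)

/-- Exchanging the two factors flips every letter. With this symmetry only one initial letter has to
be treated in later arguments. -/
theorem coef_not {n : ℕ} (e : Fin n → Bool) (t : Fin n → ℕ) (r s : ℕ → ℤ) :
    coef (fun i => !e i) t s r = coef e t r s := by
  induction n generalizing r s with
  | zero => rfl
  | succ n ih =>
    have h : Fin.tail (fun i => !e i) = fun i => !(Fin.tail e i) := rfl
    cases he : e 0 <;> simp [coef, he, h, ih, add_comm (r 0)]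

theorem vec_not {G : Type*} [CommGroup G] {n : ℕ} (e : Fin n → Bool) (w z : ℕ → G) :
    vec (fun i => !e i) z w = vec e w z := by
  induction n generalizing w z with
  | zero => rfl
  | succ n ih =>
    have h : Fin.tail (fun i => !e i) = fun i => !(Fin.tail e i) := rfl
    cases he : e 0 <;> simp [vec, he, h, ih]

/-- While `true` is read, either the weight vanishes because t₀ < r₀, or the head of s does not
increase and stays nonpositive. The first `false` then meets a vanishing weight. -/
theorem coef_eq_zero_of_right_nonpos {n : ℕ} (e : Fin n → Bool) (t : Fin n → ℕ) (r s : ℕ → ℤ)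
    (ht : ∀ i, 1 ≤ t i) (hs : s 0 ≤ 0) (he : ∃ i, e i = false) : coef e t r s = 0 := by
  induction n generalizing r s with
  | zero => exact he.choose.elim0
  | succ n ih =>
    cases h0 : e 0 with
    | false => simp [coef, h0, weight_of_nonpos (ht 0) hs]
    | true =>
      have he' : ∃ i, Fin.tail e i = false := by
        obtain ⟨i, hi⟩ := he
        induction i using Fin.cases with
        | zero => simp [h0] at hi
        | succ i => exact ⟨i, hi⟩
      simp only [coef, h0, if_true]
      rcases lt_or_ge (t 0 : ℤ) (r 0) with h1 | h1
      · rw [weight_of_lt h1, zero_mul]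
      · rw [ih (Fin.tail e) (Fin.tail t) _ _ (fun i => ht _)
          (by rw [Function.update_self]; omega) he', mul_zero]

theorem coef_eq_zero_of_left_nonpos {n : ℕ} (e : Fin n → Bool) (t : Fin n → ℕ) (r s : ℕ → ℤ)
    (ht : ∀ i, 1 ≤ t i) (hr : r 0 ≤ 0) (he : ∃ i, e i = true) : coef e t r s = 0 := by
  rw [← coef_not]
  exact coef_eq_zero_of_right_nonpos _ t s r ht hr (he.imp fun i hi => by simp [hi])

theorem coef_false {n : ℕ} (t : Fin n → ℕ) (r s : ℕ → ℤ) :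
    coef (fun _ => false) t r s = ∏ i, weight (t i) (s i) := by
  induction n generalizing r s with
  | zero => simp [coef]
  | succ n ih =>
    have h : Fin.tail (fun _ : Fin (n + 1) => false) = fun _ => false := rfl
    simp [coef, h, ih, Fin.prod_univ_succ, Fin.tail]

theorem vec_false {G : Type*} [CommGroup G] {n : ℕ} (w z : ℕ → G) :
    vec (fun _ : Fin n => false) w z = fun i : Fin n => z i := by
  induction n generalizing w z with
  | zero => exact Subsingleton.elim _ _
  | succ n ih =>
    have h : Fin.tail (fun _ : Fin (n + 1) => false) = fun _ => false := rfl
    funext i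
    simp only [vec, h, ih, Bool.false_eq_true, if_false]
    induction i using Fin.cases <;> simp

/-- Base case of the product formula. A nonzero coefficient requires tᵢ ≥ sᵢ for all i, and equality
of the sums then forces t = s. -/
theorem sum_coef_false_mul {n : ℕ} (r : ℕ → ℤ) (s : ℕ → ℕ) (hs : ∀ i, 1 ≤ s i)
    (F : (Fin n → ℕ) → ℂ) :
    ∑ t ∈ compositions n (∑ i : Fin n, s i),
      (coef (fun _ => false) t r (fun i => (s i : ℤ)) : ℂ) * F t = F fun i => s i := by
  rw [Finset.sum_eq_single_of_mem (fun i : Fin n => s i) (mem_compositions.2 ⟨rfl, fun i => hs i⟩)]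
  · rw [coef_false, Finset.prod_eq_one, Nat.cast_one, one_mul]
    intro i _
    rw [weight_eq_choose (hs _) (hs _), Nat.choose_self]
  · intro t ht hne
    rw [mem_compositions] at ht
    rw [coef_false]
    have : ∃ i, t i < s i := by
      by_contra! hle
      exact hne (funext fun i =>
        ((Finset.sum_eq_sum_iff_of_le fun i _ => hle i).1 ht.1.symm i (Finset.mem_univ i)).symm)
    obtain ⟨i, hi⟩ := this
    rw [Finset.prod_eq_zero (Finset.mem_univ i) (weight_of_lt (by exact_mod_cast hi))]
    simp

theorem words_zero (n : ℕ) : words n 0 = {fun _ => false} := by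
  ext e
  simp [mem_words, Finset.filter_eq_empty_iff, funext_iff]

theorem words_self (n : ℕ) : words n n = {fun _ => true} := by
  ext e
  rw [mem_words, Finset.mem_singleton, funext_iff]
  have h := Finset.card_filter_eq_iff (s := Finset.univ) (p := fun i : Fin n => e i = true)
  simpa using h

theorem exists_eq_true_of_mem_words {n k : ℕ} {e : Fin n → Bool} (he : e ∈ words n (k + 1)) :
    ∃ i, e i = true := by
  rw [mem_words] at he
  obtain ⟨i, hi⟩ := Finset.card_pos.1 (by omega : 0 < (Finset.univ.filter fun i => e i = true).card)
  exact ⟨i, by simpa using hi⟩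

theorem exists_eq_false_of_mem_words {n k : ℕ} {e : Fin n → Bool} (he : e ∈ words n k)
    (hk : k < n) : ∃ i, e i = false := by
  by_contra! h
  rw [mem_words, Finset.filter_true_of_mem fun i _ => by simpa using h i] at he
  simp at he
  omega

end Words

/-! ### The product formula for coefficients, indexed by words -/

section Product

theorem cons_eq_update {α : Type*} {n : ℕ} (f : ℕ → α) (a : α) :
    (Fin.cons a (Fin.tail fun i : Fin (n + 1) => f i) : Fin (n + 1) → α) =
      fun i : Fin (n + 1) => Function.update f 0 a (i : ℕ) := by
  funext i
  induction i using Fin.cases <;> simp [Fin.tail]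

theorem one_le_update {f : ℕ → ℕ} (hf : ∀ i, 1 ≤ f i) {a : ℕ} (ha : 1 ≤ a) (i : ℕ) :
    1 ≤ Function.update f 0 a i := by
  rcases eq_or_ne i 0 with rfl | hi
  · simpa using ha
  · simpa [hi] using hf i

theorem coe_update (f : ℕ → ℕ) (a : ℕ) :
    (fun i => (Function.update f 0 a i : ℤ)) = Function.update (fun i => (f i : ℤ)) 0 (a : ℤ) := by
  funext i
  rcases eq_or_ne i 0 with rfl | hi
  · simp
  · simp [hi]

theorem coe_circle_update {l : ℕ} (z : ℕ → Circle) (a : Circle) :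
    (fun i : Fin (l + 1) => (Function.update z 0 a i : ℂ)) =
      Fin.cons (a : ℂ) (Fin.tail fun i : Fin (l + 1) => (z i : ℂ)) := by
  funext i
  induction i using Fin.cases <;> simp [Fin.tail]

theorem term_zero {s : Fin 0 → ℕ} {z : Fin 0 → ℂ} (N : ℕ) :
    term s z N = if N = 0 then 1 else 0 := rfl

/-- The summand of the product formula for the exponents `t` and the shuffle given by `e`. -/
noncomputable def summand {n : ℕ} (r s : ℕ → ℤ) (w z : ℕ → Circle) (N : ℕ)
    (t : Fin n → ℕ) (e : Fin n → Bool) : ℂ :=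
  (coef e t r s : ℂ) * term t (fun i => ((vec e w z i : Circle) : ℂ)) N

theorem summand_cons_true {n : ℕ} (r s : ℕ → ℤ) (w z : ℕ → Circle) (N : ℕ) (a : ℕ)
    (t : Fin n → ℕ) (e : Fin n → Bool) :
    summand r s w z N (Fin.cons a t : Fin (n + 1) → ℕ) (Fin.cons true e) =
      weight a (r 0) * ((w 0 : ℂ) ^ N / (N : ℂ) ^ a * ∑ m ∈ Finset.range N,
        summand (fun i => r (i + 1)) (Function.update s 0 (r 0 + s 0 - a))
          (fun i => w (i + 1)) (Function.update z 0 (z 0 / w 0)) m t e) := by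
  simp only [summand, coef, vec, term_succ_eq, Fin.cons_zero, if_true, Fin.tail_cons,
    ← Finset.mul_sum, Nat.cast_mul]
  rw [show (Fin.tail fun i : Fin (n + 1) => (((Fin.cons (w 0) (vec e (fun i => w (i + 1))
    (Function.update z 0 (z 0 / w 0))) : Fin (n + 1) → Circle) i : Circle) : ℂ)) =
    fun i => ((vec e (fun i => w (i + 1)) (Function.update z 0 (z 0 / w 0)) i : Circle) : ℂ) from rfl]
  ring

theorem summand_cons_false {n : ℕ} (r s : ℕ → ℤ) (w z : ℕ → Circle) (N : ℕ) (a : ℕ)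
    (t : Fin n → ℕ) (e : Fin n → Bool) :
    summand r s w z N (Fin.cons a t : Fin (n + 1) → ℕ) (Fin.cons false e) =
      weight a (s 0) * ((z 0 : ℂ) ^ N / (N : ℂ) ^ a * ∑ m ∈ Finset.range N,
        summand (Function.update r 0 (r 0 + s 0 - a)) (fun i => s (i + 1))
          (Function.update w 0 (w 0 / z 0)) (fun i => z (i + 1)) m t e) := by
  simp only [summand, coef, vec, term_succ_eq, Fin.cons_zero, if_false, Fin.tail_cons,
    ← Finset.mul_sum, Nat.cast_mul, Bool.false_eq_true]
  rw [show (Fin.tail fun i : Fin (n + 1) => (((Fin.cons (z 0) (vec e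
    (Function.update w 0 (w 0 / z 0)) (fun i => z (i + 1))) : Fin (n + 1) → Circle) i : Circle) :
      ℂ)) =
    fun i => ((vec e (Function.update w 0 (w 0 / z 0)) (fun i => z (i + 1)) i : Circle) : ℂ) from rfl]
  ring

theorem sum_summand_words_zero {n : ℕ} (r : ℕ → ℤ) (s : ℕ → ℕ) (hs : ∀ i, 1 ≤ s i)
    (w z : ℕ → Circle) (N : ℕ) :
    ∑ t ∈ compositions n (∑ i : Fin n, s i), ∑ e ∈ words n 0,
      summand r (fun i => (s i : ℤ)) w z N t e =
        term (fun i : Fin n => s i) (fun i : Fin n => (z i : ℂ)) N := by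
  simp only [words_zero, Finset.sum_singleton, summand]
  rw [sum_coef_false_mul r s hs fun t => term t (fun i => ((vec (fun _ => false) w z i : Circle) : ℂ)) N,
    vec_false]

theorem summand_not {n : ℕ} (r s : ℕ → ℤ) (w z : ℕ → Circle) (N : ℕ)
    (t : Fin n → ℕ) (e : Fin n → Bool) :
    summand s r z w N t (fun i => !e i) = summand r s w z N t e := by
  simp only [summand, coef_not, vec_not]

theorem sum_summand_words_self {n : ℕ} (r : ℕ → ℕ) (s : ℕ → ℤ) (hr : ∀ i, 1 ≤ r i)
    (w z : ℕ → Circle) (N : ℕ) :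
    ∑ t ∈ compositions n (∑ i : Fin n, r i), ∑ e ∈ words n n,
      summand (fun i => (r i : ℤ)) s w z N t e =
        term (fun i : Fin n => r i) (fun i : Fin n => (w i : ℂ)) N := by
  rw [← sum_summand_words_zero s r hr z w N]
  refine Finset.sum_congr rfl fun t _ => ?_
  rw [words_self, words_zero, Finset.sum_singleton, Finset.sum_singleton, ← summand_not]
  rfl

/-- The product formula for the coefficients of two multiple polylogarithm series. -/
theorem sum_antidiagonal_term_mul_term {n k l : ℕ} (hn : k + l = n) (r s : ℕ → ℕ)
    (hr : ∀ i, 1 ≤ r i) (hs : ∀ i, 1 ≤ s i) (w z : ℕ → Circle) (N : ℕ) :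
    ∑ p ∈ Finset.HasAntidiagonal.antidiagonal N,
      term (fun i : Fin k => r i) (fun i : Fin k => (w i : ℂ)) p.1 *
        term (fun i : Fin l => s i) (fun i : Fin l => (z i : ℂ)) p.2 =
      ∑ t ∈ compositions n ((∑ i : Fin k, r i) + ∑ i : Fin l, s i), ∑ e ∈ words n k,
        summand (fun i => (r i : ℤ)) (fun i => (s i : ℤ)) w z N t e := by
  induction n generalizing k l r s w z N with
  | zero =>
    obtain ⟨rfl, rfl⟩ : k = 0 ∧ l = 0 := by omega
    have := sum_summand_words_zero (n := 0) (fun i => (r i : ℤ)) s hs w z N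
    simp only [Finset.univ_eq_empty, Finset.sum_empty, add_zero] at this ⊢
    -- The series of depth 0 has only the coefficient at 0, so one pair of the antidiagonal
    -- survives.
    rw [this, Finset.sum_eq_single_of_mem (0, N) (by simp)]
    · simp [term_zero]
    · rintro ⟨a, b⟩ hab hne
      have ha : a ≠ 0 := by
        rintro rfl
        simp at hab
        simp [hab] at hne
      simp [term_zero, ha]
  | succ n ih =>
    rcases k with _ | k
    · obtain rfl : l = n + 1 := by omega
      have := sum_summand_words_zero (n := n + 1) (fun i => (r i : ℤ)) s hs w z N
      simp only [Finset.univ_eq_empty, Finset.sum_empty, zero_add] at this ⊢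
      rw [this, Finset.sum_eq_single_of_mem (0, N) (by simp)]
      · simp [term_zero]
      · rintro ⟨a, b⟩ hab hne
        have ha : a ≠ 0 := by
          rintro rfl
          simp at hab
          simp [hab] at hne
        simp [term_zero, ha]
    rcases l with _ | l
    · obtain rfl : k = n := by omega
      have := sum_summand_words_self (n := k + 1) r (fun i => (s i : ℤ)) hr w z N
      simp only [Finset.univ_eq_empty, Finset.sum_empty, add_zero] at this ⊢
      rw [this, Finset.sum_eq_single_of_mem (N, 0) (by simp)]
      · simp [term_zero]
      · rintro ⟨a, b⟩ hab hne
        have hb : b ≠ 0 := by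
          rintro rfl
          simp at hab
          simp [hab] at hne
        simp [term_zero, hb]
    set M := (∑ i : Fin (k + 1), r i) + ∑ i : Fin (l + 1), s i with hM
    have hM' : M = r 0 + (∑ i : Fin k, r (i + 1)) + (s 0 + ∑ i : Fin l, s (i + 1)) := by
      rw [hM, Fin.sum_univ_succ, Fin.sum_univ_succ]; rfl
    rw [sum_antidiagonal_term_mul_term_succ (fun i : Fin (k + 1) => r i)
      (fun i : Fin (l + 1) => s i) _ _ (hr 0) (hs 0) (Circle.coe_ne_zero _) (Circle.coe_ne_zero _),
      sum_compositions_succ]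
    simp only [Fin.val_zero]
    symm
    -- Partial fractions give first entries below r₀ + s₀, while compositions allow larger ones. For
    -- those the new head r₀ + s₀ - a is nonpositive, and its letter still occurs later in the word,
    -- so the coefficient vanishes.
    refine (Finset.sum_subset (s₁ := Finset.Ico 1 (r 0 + s 0)) ?_ ?_).symm.trans ?_
    · intro a ha
      rw [Finset.mem_Ico] at ha
      rw [Finset.mem_Icc]
      omega
    · intro a ha ha'
      rw [Finset.mem_Icc] at ha
      rw [Finset.mem_Ico] at ha'
      refine Finset.sum_eq_zero fun t ht => Finset.sum_eq_zero fun e he => ?_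
      rw [mem_compositions] at ht
      have hcoef : coef e (Fin.cons a t : Fin (n + 1) → ℕ) (fun i => (r i : ℤ))
          (fun i => (s i : ℤ)) = 0 := by
        cases h0 : e 0 with
        | true =>
          obtain ⟨i, hi⟩ := exists_eq_false_of_mem_words he (by omega)
          have : ∃ i, Fin.tail e i = false := by
            induction i using Fin.cases with
            | zero => simp [h0] at hi
            | succ i => exact ⟨i, hi⟩
          simp only [coef, h0, if_true, Fin.cons_zero, Fin.tail_cons]
          rw [coef_eq_zero_of_right_nonpos _ t _ _ ht.2 (by rw [Function.update_self]; omega) this,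
            mul_zero]
        | false =>
          obtain ⟨i, hi⟩ := exists_eq_true_of_mem_words he
          have : ∃ i, Fin.tail e i = true := by
            induction i using Fin.cases with
            | zero => simp [h0] at hi
            | succ i => exact ⟨i, hi⟩
          simp only [coef, h0, if_false, Bool.false_eq_true, Fin.cons_zero, Fin.tail_cons]
          rw [coef_eq_zero_of_left_nonpos _ t _ _ ht.2 (by rw [Function.update_self]; omega) this,
            mul_zero]
      rw [summand, hcoef, Nat.cast_zero, zero_mul]
    · refine Finset.sum_congr rfl fun a ha => ?_
      rw [Finset.mem_Ico] at ha
      -- Truncated subtraction is harmless in the range a < r₀ + s₀.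
      have hcast : ((r 0 + s 0 - a : ℕ) : ℤ) = r 0 + s 0 - a := by omega
      simp_rw [sum_words_succ, Finset.sum_add_distrib, summand_cons_true, summand_cons_false,
        ← Finset.mul_sum]
      congr 1
      · congr 2
        simp only [Finset.sum_comm (t := Finset.range N)]
        refine Finset.sum_congr rfl fun m _ => ?_
        have := ih (k := k) (l := l + 1) (by omega) (fun i => r (i + 1))
          (Function.update s 0 (r 0 + s 0 - a)) (fun i => hr _)
          (one_le_update hs (by omega)) (fun i => w (i + 1)) (Function.update z 0 (z 0 / w 0)) m
        rw [show (∑ i : Fin k, r (i + 1)) + ∑ i : Fin (l + 1), Function.update s 0 (r 0 + s 0 - a) i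
          = M - a by rw [Fin.sum_univ_succ]; simp; omega] at this
        rw [coe_update, hcast, coe_circle_update, ← cons_eq_update, Circle.coe_div] at this
        exact this.symm
      · congr 2
        simp only [Finset.sum_comm (t := Finset.range N)]
        refine Finset.sum_congr rfl fun m _ => ?_
        have := ih (k := k + 1) (l := l) (by omega) (Function.update r 0 (r 0 + s 0 - a))
          (fun i => s (i + 1)) (one_le_update hr (by omega)) (fun i => hs _)
          (Function.update w 0 (w 0 / z 0)) (fun i => z (i + 1)) m
        rw [show (∑ i : Fin (k + 1), Function.update r 0 (r 0 + s 0 - a) i) + ∑ i : Fin l, s (i + 1)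
          = M - a by rw [Fin.sum_univ_succ]; simp; omega] at this
        rw [coe_update, hcast, coe_circle_update, ← cons_eq_update, Circle.coe_div] at this
        exact this.symm

end Product

/-! ### Closed forms for coefficients and arguments -/

section ClosedForm

/-- The number of letters `b` before position `i` of the word `e`. -/
def countBefore (b : Bool) (e : ℕ → Bool) (i : ℕ) : ℕ := Nat.count (fun j => e j = b) i

theorem countBefore_zero (b : Bool) (e : ℕ → Bool) : countBefore b e 0 = 0 := by
  simp [countBefore]

theorem countBefore_succ (b : Bool) (e : ℕ → Bool) (i : ℕ) :
    countBefore b e (i + 1) = countBefore b e i + if e i = b then 1 else 0 := by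
  simp [countBefore, Nat.count_succ]

theorem countBefore_succ' (b : Bool) (e : ℕ → Bool) (i : ℕ) :
    countBefore b e (i + 1) =
      countBefore b (fun j => e (j + 1)) i + if e 0 = b then 1 else 0 := by
  simp [countBefore, Nat.count_succ']

theorem countBefore_not (b : Bool) (e : ℕ → Bool) :
    countBefore b (fun j => !e j) = countBefore (!b) e := by
  funext i
  unfold countBefore
  congr! 2
  cases b <;> simp

/-- The entry at position `i` of the shuffle, given by the word `e`, of two sequences. -/
def shuffled {α : Type*} (r s : ℕ → α) (e : ℕ → Bool) (i : ℕ) : α :=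
  if e i = true then r (countBefore true e i) else s (countBefore false e i)

theorem shuffled_not {α : Type*} (r s : ℕ → α) (e : ℕ → Bool) :
    shuffled s r (fun j => !e j) = shuffled r s e := by
  funext i
  cases h : e i <;> simp [shuffled, h, countBefore_not]

/-- The factor at position `i` of the coefficient of a shuffle in the product formula. -/
def coefFactor (e : ℕ → Bool) (t : ℕ → ℕ) (r s : ℕ → ℤ) (i : ℕ) : ℕ :=
  if i = 0 ∨ e (i - 1) = e i then weight (t i) (shuffled r s e i)
  else weight (t i)
    (∑ j ∈ Finset.range (i + 1), shuffled r s e j - ∑ j ∈ Finset.range i, (t j : ℤ))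

theorem coefFactor_not (e : ℕ → Bool) (t : ℕ → ℕ) (r s : ℕ → ℤ) :
    coefFactor (fun j => !e j) t s r = coefFactor e t r s := by
  funext i
  simp [coefFactor, shuffled_not]

/-- Changing the head of s affects the sum only once the first `false` has been read. -/
theorem sum_shuffled_tail {e : ℕ → Bool} (h0 : e 0 = true) (a : ℤ) (r s : ℕ → ℤ) (i : ℕ) :
    ∑ j ∈ Finset.range i, shuffled (fun i => r (i + 1)) (Function.update s 0 (s 0 + a))
        (fun j => e (j + 1)) j =
      ∑ j ∈ Finset.range i, shuffled r s e (j + 1) +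
        if countBefore false (fun j => e (j + 1)) i = 0 then 0 else a := by
  induction i with
  | zero => simp [countBefore_zero]
  | succ i ih =>
    have hsucc : shuffled r s e (i + 1) =
        if e (i + 1) = true then r (countBefore true (fun j => e (j + 1)) i + 1)
        else s (countBefore false (fun j => e (j + 1)) i) := by
      simp [shuffled, countBefore_succ', h0]
    rw [Finset.sum_range_succ, Finset.sum_range_succ, ih, hsucc, countBefore_succ false]
    cases h1 : e (i + 1) with
    | true => simp [shuffled, h1]; ring
    | false =>
      by_cases h2 : countBefore false (fun j => e (j + 1)) i = 0
      · simp [shuffled, h1, h2]; ring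
      · simp [shuffled, h1, h2]; ring

/-- Deleting the initial letter removes r₀ - t₀ from the difference of the two sums, and the new
head of s returns exactly this amount. Where a letter repeats, only single entries matter, and the
altered head is not among them unless it comes directly after the deleted letter. -/
theorem coefFactor_tail {e : ℕ → Bool} (h0 : e 0 = true) (t : ℕ → ℕ) (r s : ℕ → ℤ) (i : ℕ) :
    coefFactor (fun j => e (j + 1)) (fun j => t (j + 1)) (fun i => r (i + 1))
        (Function.update s 0 (r 0 + s 0 - t 0)) i =
      coefFactor e t r s (i + 1) := by
  have hupd : r 0 + s 0 - t 0 = s 0 + (r 0 - t 0) := by ring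
  have h00 : shuffled r s e 0 = r 0 := by simp [shuffled, h0, countBefore_zero]
  rw [hupd]
  unfold coefFactor
  rw [sum_shuffled_tail h0, Finset.sum_range_succ' _ (i + 1), Finset.sum_range_succ' _ i, h00]
  rcases i with _ | i
  · cases h1 : e 1
    · simp [shuffled, h0, h1, countBefore_zero, countBefore_succ]
      congr 1
      ring
    · simp [shuffled, h0, h1, countBefore_zero, countBefore_succ]
  · simp only [Nat.add_sub_cancel, Nat.add_eq_zero_iff, one_ne_zero, and_false, false_or]
    by_cases h1 : e (i + 1) = e (i + 1 + 1)
    · rw [if_pos h1, if_pos h1]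
      congr 1
      cases h2 : e (i + 1 + 1) with
      | true => simp [shuffled, h2, countBefore_succ' true e, h0]
      | false => simp [shuffled, h2, h1, countBefore_succ' false e, countBefore_succ, h0]
    · rw [if_neg h1, if_neg h1]
      -- At a change of letter one of the two letters is `false`, so the altered head has been
      -- counted.
      have h3 : countBefore false (fun j => e (j + 1)) (i + 1 + 1) ≠ 0 := by
        rw [countBefore_succ, countBefore_succ]
        cases h2 : e (i + 1) <;> cases h3 : e (i + 1 + 1) <;> simp_all
      rw [if_neg h3, Finset.sum_range_succ' (fun j => (t j : ℤ)) (i + 1)]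
      congr 1
      ring

theorem coef_eq_prod (n : ℕ) (e : ℕ → Bool) (t : ℕ → ℕ) (r s : ℕ → ℤ) :
    coef (fun i : Fin n => e i) (fun i => t i) r s =
      ∏ i ∈ Finset.range n, coefFactor e t r s i := by
  -- Only words beginning with `true` are treated here; flipping all letters covers the others.
  have key : ∀ n, (∀ (e : ℕ → Bool) (t : ℕ → ℕ) (r s : ℕ → ℤ),
      coef (fun i : Fin n => e i) (fun i => t i) r s =
        ∏ i ∈ Finset.range n, coefFactor e t r s i) →
      ∀ (e : ℕ → Bool) (t : ℕ → ℕ) (r s : ℕ → ℤ), e 0 = true →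
      coef (fun i : Fin (n + 1) => e i) (fun i => t i) r s =
        ∏ i ∈ Finset.range (n + 1), coefFactor e t r s i := by
    intro n ih e t r s h0
    have h1 := ih (fun j => e (j + 1)) (fun j => t (j + 1)) (fun i => r (i + 1))
      (Function.update s 0 (r 0 + s 0 - t 0))
    simp_rw [coefFactor_tail h0] at h1
    rw [Finset.prod_range_succ', ← h1, mul_comm]
    simp only [coef, Fin.val_zero, h0, if_true]
    congr 1
    simp [coefFactor, shuffled, h0, countBefore_zero]
  induction n generalizing e t r s with
  | zero => simp [coef]
  | succ n ih =>
    cases h0 : e 0 with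
    | true => exact key n ih e t r s h0
    | false =>
      rw [← coef_not, ← coefFactor_not]
      exact key n ih (fun j => !e j) t s r (by simp [h0])

variable {G : Type*} [CommGroup G]

/-- The argument at position `i` belonging to a shuffle in the product formula. -/
def vecEntry (e : ℕ → Bool) (w z : ℕ → G) (i : ℕ) : G :=
  if i = 0 ∨ e (i - 1) = e i then shuffled w z e i
  else if e i = true then
    (∏ m ∈ Finset.range (countBefore true e i + 1), w m) /
      ∏ m ∈ Finset.range (countBefore false e i), z m
  else
    (∏ m ∈ Finset.range (countBefore false e i + 1), z m) /
      ∏ m ∈ Finset.range (countBefore true e i), w m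

theorem vecEntry_not (e : ℕ → Bool) (w z : ℕ → G) :
    vecEntry (fun j => !e j) z w = vecEntry e w z := by
  funext i
  cases h : e i <;> simp [vecEntry, shuffled_not, countBefore_not, h]

theorem prod_range_update (z : ℕ → G) (a : G) (n : ℕ) :
    ∏ m ∈ Finset.range (n + 1), Function.update z 0 (z 0 / a) m =
      (∏ m ∈ Finset.range (n + 1), z m) / a := by
  rw [Finset.prod_range_succ', Finset.prod_range_succ' z]
  simp [mul_div_assoc]

/-- The multiplicative analogue of `coefFactor_tail`: every nonempty partial product of z is divided
by w₀, which restores the w₀ lost with the first letter in the quotients. -/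
theorem vecEntry_tail {e : ℕ → Bool} (h0 : e 0 = true) (w z : ℕ → G) (i : ℕ) :
    vecEntry (fun j => e (j + 1)) (fun i => w (i + 1)) (Function.update z 0 (z 0 / w 0)) i =
      vecEntry e w z (i + 1) := by
  unfold vecEntry
  rcases i with _ | i
  · cases h1 : e 1 <;> simp [shuffled, h0, h1, countBefore_zero, countBefore_succ]
  · simp only [Nat.add_sub_cancel, Nat.add_eq_zero_iff, one_ne_zero, and_false, false_or]
    rw [countBefore_succ' true e (i + 1), countBefore_succ' false e (i + 1), prod_range_update]
    by_cases h1 : e (i + 1) = e (i + 1 + 1)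
    · rw [if_pos h1, if_pos h1]
      cases h2 : e (i + 1 + 1) with
      | true => simp [shuffled, h2, countBefore_succ' true e, h0]
      | false => simp [shuffled, h2, h1, countBefore_succ' false e, countBefore_succ, h0]
    · rw [if_neg h1, if_neg h1]
      cases h2 : e (i + 1 + 1) with
      | true =>
        -- The preceding letter makes the product over z nonempty, so it contains the altered head.
        have h3 : e (i + 1) = false := by simpa [h2] using h1
        simp only [if_true, h0, countBefore_succ false (fun j => e (j + 1)), h3, prod_range_update,
          Bool.true_eq_false, if_false, add_zero]
        rw [Finset.prod_range_succ' w]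
        simp [div_div_eq_mul_div]
      | false =>
        simp only [if_false, Bool.false_eq_true, Bool.true_eq_false, h0, if_true, add_zero]
        rw [Finset.prod_range_succ' w, div_div, mul_comm (w 0)]

theorem vec_eq_vecEntry (n : ℕ) (e : ℕ → Bool) (w z : ℕ → G) :
    vec (fun i : Fin n => e i) w z = fun i : Fin n => vecEntry e w z i := by
  have key : ∀ n, (∀ (e : ℕ → Bool) (w z : ℕ → G),
      vec (fun i : Fin n => e i) w z = fun i : Fin n => vecEntry e w z i) →
      ∀ (e : ℕ → Bool) (w z : ℕ → G), e 0 = true →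
      vec (fun i : Fin (n + 1) => e i) w z = fun i : Fin (n + 1) => vecEntry e w z i := by
    intro n ih e w z h0
    have h1 := ih (fun j => e (j + 1)) (fun i => w (i + 1)) (Function.update z 0 (z 0 / w 0))
    simp_rw [vecEntry_tail h0] at h1
    funext i
    simp only [vec, Fin.val_zero, h0, if_true]
    induction i using Fin.cases with
    | zero => simp [vecEntry, shuffled, h0, countBefore_zero]
    | succ i => exact congrFun h1 i
  induction n generalizing e w z with
  | zero => exact Subsingleton.elim _ _
  | succ n ih =>
    cases h0 : e 0 with
    | true => exact key n ih e w z h0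
    | false =>
      rw [← vec_not, ← vecEntry_not]
      exact key n ih (fun j => !e j) z w (by simp [h0])

end ClosedForm

/-! ### From words to shuffles -/

section Shuffles

/-- The sequence that continues a tuple by the constant value `1`. -/
def extendOne {α : Type*} [One α] {k : ℕ} (f : Fin k → α) (i : ℕ) : α :=
  if h : i < k then f ⟨i, h⟩ else 1

@[simp]
theorem extendOne_val {α : Type*} [One α] {k : ℕ} (f : Fin k → α) (i : Fin k) :
    extendOne f i = f i := by
  simp [extendOne]

/-- The filler 1 keeps exponents positive along the whole sequence, as the product formula for
sequences demands. -/
theorem one_le_extendOne {k : ℕ} {f : Fin k → ℕ} (hf : ∀ i, 1 ≤ f i) (i : ℕ) :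
    1 ≤ extendOne f i := by
  unfold extendOne
  split_ifs
  · exact hf _
  · exact le_rfl

theorem prod_filter_lt_eq_prod_range {G : Type*} [CommMonoid G] {k : ℕ} (f : Fin k → G) (N : ℕ) :
    ∏ m ∈ Finset.univ.filter (fun m : Fin k => (m : ℕ) < N), f m =
      ∏ m ∈ Finset.range N, extendOne f m := by
  rw [← Finset.prod_subset (s₁ := (Finset.univ.filter fun m : Fin k => (m : ℕ) < N).map
    Fin.valEmbedding)]
  · simp
  · intro m hm
    obtain ⟨i, hi, rfl⟩ := Finset.mem_map.1 hm
    simpa using hi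
  · intro m hm hm'
    unfold extendOne
    rw [dif_neg]
    intro hlt
    exact hm' (Finset.mem_map.2 ⟨⟨m, hlt⟩, by simpa using hm, rfl⟩)

theorem sum_Iic_eq_sum_range {n : ℕ} (f : ℕ → ℤ) (i : Fin n) :
    ∑ j ∈ Finset.Iic i, f j = ∑ j ∈ Finset.range (i + 1), f j := by
  rw [Nat.range_succ_eq_Iic, ← Fin.map_valEmbedding_Iic, Finset.sum_map]
  rfl

open scoped Classical in
/-- The word with the letter `true` at the places in the image of `φ`. -/
noncomputable def wordOf {k n : ℕ} (φ : Fin k → Fin n) (i : ℕ) : Bool :=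
  decide (∃ j, (φ j : ℕ) = i)

theorem wordOf_eq_true_iff {k n : ℕ} {φ : Fin k → Fin n} {i : ℕ} :
    wordOf φ i = true ↔ ∃ j, (φ j : ℕ) = i := by
  simp [wordOf]

/-- By monotonicity the letters b before χ(j) sit exactly at the images of the indices below j. -/
theorem countBefore_of_strictMono {k n : ℕ} {χ : Fin k → Fin n} (hχ : StrictMono χ)
    {b : Bool} {e : ℕ → Bool} (he : ∀ i < n, e i = b ↔ ∃ j, (χ j : ℕ) = i) (j : Fin k) :
    countBefore b e (χ j) = j := by
  unfold countBefore
  rw [Nat.count_eq_card_filter_range]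
  have : (Finset.range (χ j)).filter (fun i => e i = b) =
      (Finset.Iio j).image fun m => (χ m : ℕ) := by
    ext i
    simp only [Finset.mem_filter, Finset.mem_range, Finset.mem_image, Finset.mem_Iio]
    constructor
    · rintro ⟨h1, h2⟩
      obtain ⟨m, rfl⟩ := (he i (h1.trans (χ j).2)).1 h2
      exact ⟨m, hχ.lt_iff_lt.1 h1, rfl⟩
    · rintro ⟨m, hm, rfl⟩
      exact ⟨hχ hm, (he _ (χ m).2).2 ⟨m, rfl⟩⟩
  rw [this]
  exact (Finset.card_image_of_injective _ (Fin.val_injective.comp hχ.injective)).trans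
    (Fin.card_Iio j)

theorem countBefore_add (e : ℕ → Bool) (i : ℕ) :
    countBefore true e i + countBefore false e i = i := by
  induction i with
  | zero => simp [countBefore_zero]
  | succ i ih =>
    rw [countBefore_succ, countBefore_succ]
    cases e i <;> simp <;> omega

variable {k l : ℕ} {φ : Fin k → Fin (k + l)} {ψ : Fin l → Fin (k + l)}

theorem mem_shuffles_iff : (φ, ψ) ∈ shuffles k l ↔ StrictMono φ ∧ StrictMono ψ ∧
    Disjoint (Set.range φ) (Set.range ψ) ∧ Set.range φ ∪ Set.range ψ = Set.univ := by
  simp [shuffles]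

theorem ne_of_mem_shuffles (hp : (φ, ψ) ∈ shuffles k l) (i : Fin k) (j : Fin l) : φ i ≠ ψ j :=
  fun h => Set.disjoint_left.1 (mem_shuffles_iff.1 hp).2.2.1 ⟨i, rfl⟩ ⟨j, h.symm⟩

theorem exists_of_mem_shuffles (hp : (φ, ψ) ∈ shuffles k l) (i : Fin (k + l)) :
    (∃ j, φ j = i) ∨ ∃ j, ψ j = i := by
  have := Set.mem_univ i
  rwa [← (mem_shuffles_iff.1 hp).2.2.2] at this

theorem wordOf_eq_false_iff (hp : (φ, ψ) ∈ shuffles k l) {i : ℕ} (hi : i < k + l) :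
    wordOf φ i = false ↔ ∃ j, (ψ j : ℕ) = i := by
  rw [← Bool.not_eq_true, wordOf_eq_true_iff]
  constructor
  · intro h
    rcases exists_of_mem_shuffles hp ⟨i, hi⟩ with ⟨j, hj⟩ | ⟨j, hj⟩
    · exact absurd ⟨j, by rw [hj]⟩ h
    · exact ⟨j, by rw [hj]⟩
  · rintro ⟨j, rfl⟩ ⟨m, hm⟩
    exact ne_of_mem_shuffles hp m j (Fin.ext hm)

theorem wordOf_left (φ : Fin k → Fin (k + l)) (j : Fin k) : wordOf φ (φ j) = true :=
  wordOf_eq_true_iff.2 ⟨j, rfl⟩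

theorem wordOf_right (hp : (φ, ψ) ∈ shuffles k l) (j : Fin l) : wordOf φ (ψ j) = false :=
  (wordOf_eq_false_iff hp (ψ j).2).2 ⟨j, rfl⟩

theorem countBefore_left (hp : (φ, ψ) ∈ shuffles k l) (j : Fin k) :
    countBefore true (wordOf φ) (φ j) = j :=
  countBefore_of_strictMono (mem_shuffles_iff.1 hp).1 (fun _ _ => wordOf_eq_true_iff) j

theorem countBefore_right (hp : (φ, ψ) ∈ shuffles k l) (j : Fin l) :
    countBefore false (wordOf φ) (ψ j) = j :=
  countBefore_of_strictMono (mem_shuffles_iff.1 hp).2.1 (fun _ hi => wordOf_eq_false_iff hp hi) j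

theorem inIm_left_iff {i : Fin (k + l)} : InIm φ i ↔ wordOf φ i = true := by
  simp [InIm, wordOf_eq_true_iff, Fin.ext_iff]

theorem inIm_right_iff (hp : (φ, ψ) ∈ shuffles k l) {i : Fin (k + l)} :
    InIm ψ i ↔ wordOf φ i = false := by
  simp [InIm, wordOf_eq_false_iff hp i.2, Fin.ext_iff]

theorem predInIm_left_iff {i : Fin (k + l)} :
    PredInIm φ i ↔ (i : ℕ) ≠ 0 ∧ wordOf φ (i - 1) = true := by
  rw [wordOf_eq_true_iff]
  constructor
  · rintro ⟨j, hj⟩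
    exact ⟨by omega, j, by omega⟩
  · rintro ⟨h, j, hj⟩
    exact ⟨j, by omega⟩

theorem predInIm_right_iff (hp : (φ, ψ) ∈ shuffles k l) {i : Fin (k + l)} :
    PredInIm ψ i ↔ (i : ℕ) ≠ 0 ∧ wordOf φ (i - 1) = false := by
  rw [wordOf_eq_false_iff hp (by omega)]
  constructor
  · rintro ⟨j, hj⟩
    exact ⟨by omega, j, by omega⟩
  · rintro ⟨h, j, hj⟩
    exact ⟨j, by omega⟩

theorem h_eq_shuffled (hp : (φ, ψ) ∈ shuffles k l) (r : Fin k → ℕ) (s : Fin l → ℕ)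
    (i : Fin (k + l)) :
    h r s φ ψ i = shuffled (extendOne r) (extendOne s) (wordOf φ) i := by
  have h1 := (mem_shuffles_iff.1 hp).1.injective
  have h2 := (mem_shuffles_iff.1 hp).2.1.injective
  unfold h shuffled
  rcases exists_of_mem_shuffles hp i with ⟨j, rfl⟩ | ⟨j, rfl⟩
  · rw [if_pos (wordOf_left φ j), countBefore_left hp, extendOne_val,
      Finset.filter_false_of_mem fun m _ => (ne_of_mem_shuffles hp j m).symm]
    simp [h1.eq_iff, Finset.filter_eq']
  · rw [wordOf_right hp j, countBefore_right hp, extendOne_val,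
      Finset.filter_false_of_mem fun m _ => ne_of_mem_shuffles hp m j]
    simp [h2.eq_iff, Finset.filter_eq']

/-- In the first case the two binomials agree by symmetry, which needs h ≥ 1. In the second, tᵢ
joins the sum over earlier t and makes it run up to i. -/
theorem c_eq_coefFactor (hp : (φ, ψ) ∈ shuffles k l) {r : Fin k → ℕ} {s : Fin l → ℕ}
    {t : Fin (k + l) → ℕ} (hr : ∀ i, 1 ≤ r i) (hs : ∀ i, 1 ≤ s i) (ht : ∀ i, 1 ≤ t i)
    (i : Fin (k + l)) :
    c r s t φ ψ i = coefFactor (wordOf φ) (extendOne t) (fun j => ((extendOne r j : ℕ) : ℤ))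
      (fun j => ((extendOne s j : ℕ) : ℤ)) i := by
  have hcast : ∀ j, shuffled (fun j => ((extendOne r j : ℕ) : ℤ)) (fun j => ((extendOne s j : ℕ) : ℤ))
      (wordOf φ) j = (shuffled (extendOne r) (extendOne s) (wordOf φ) j : ℕ) := by
    intro j
    simp only [shuffled]
    split_ifs <;> rfl
  have hpos : 1 ≤ shuffled (extendOne r) (extendOne s) (wordOf φ) i := by
    unfold shuffled
    split_ifs
    · exact one_le_extendOne hr _
    · exact one_le_extendOne hs _
  have hcond : ((i : ℕ) = 0 ∨ (PredInIm φ i ∧ InIm φ i) ∨ (PredInIm ψ i ∧ InIm ψ i)) ↔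
      ((i : ℕ) = 0 ∨ wordOf φ (i - 1) = wordOf φ i) := by
    rw [predInIm_left_iff, predInIm_right_iff hp, inIm_left_iff, inIm_right_iff hp]
    by_cases h0 : (i : ℕ) = 0
    · simp [h0]
    · cases wordOf φ (i - 1) <;> cases wordOf φ i <;> simp [h0]
  unfold c coefFactor
  simp only [hcond, hcast, extendOne_val]
  split_ifs
  · rw [weight_eq_choose (ht i) hpos, binom, h_eq_shuffled hp, if_pos (by omega)]
    congr 1
    omega
  · unfold weight
    congr 1
    simp_rw [h_eq_shuffled hp]
    rw [sum_Iic_eq_sum_range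
      (fun j => ((shuffled (extendOne r) (extendOne s) (wordOf φ) j : ℕ) : ℤ))]
    have := sum_Iic_eq_sum_range (fun j => ((extendOne t j : ℕ) : ℤ)) i
    simp only [extendOne_val] at this
    rw [this, Finset.sum_range_succ _ (i : ℕ), extendOne_val]
    ring

theorem primedShuffle_eq_vecEntry {G : Type*} [CommGroup G] (hp : (φ, ψ) ∈ shuffles k l)
    (w : Fin k → G) (z : Fin l → G) (i : Fin (k + l)) :
    primedShuffle φ ψ w z i = vecEntry (wordOf φ) (extendOne w) (extendOne z) i := by
  have h1 := (mem_shuffles_iff.1 hp).1.injective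
  have h2 := (mem_shuffles_iff.1 hp).2.1.injective
  have hIic : ∀ {m : ℕ} (f : Fin m → G) (j : Fin m),
      ∏ a ∈ Finset.Iic j, f a = ∏ a ∈ Finset.range (j + 1), extendOne f a := by
    intro m f j
    rw [← prod_filter_lt_eq_prod_range]
    refine Finset.prod_congr (Finset.ext fun a => ?_) fun _ _ => rfl
    rw [Finset.mem_Iic, Finset.mem_filter_univ, Fin.le_def, Nat.lt_succ_iff]
  have hadd := countBefore_add (wordOf φ) i
  unfold primedShuffle vecEntry
  rw [predInIm_left_iff, predInIm_right_iff hp]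
  by_cases hi : InIm φ i
  · rw [dif_pos hi]
    obtain ⟨j, hj⟩ : ∃ j, hi.choose = j := ⟨_, rfl⟩
    have hφ : φ j = i := by rw [← hj]; exact hi.choose_spec
    rw [hj]
    have hw : wordOf φ i = true := inIm_left_iff.1 hi
    have hcj : countBefore true (wordOf φ) i = j := by rw [← hφ]; exact countBefore_left hp j
    -- Of the i letters before position i, j are `true`, so i - j are `false`.
    rw [hw, hcj, hIic, prod_filter_lt_eq_prod_range,
      show countBefore false (wordOf φ) i = i - j by omega]
    by_cases h0 : (i : ℕ) = 0
    · rw [if_pos (Or.inl h0), if_pos (Or.inl h0)]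
      simp [shuffled, hw, hcj]
    · simp [h0, shuffled, hw, hcj]
  · have hi' : InIm ψ i := (exists_of_mem_shuffles hp i).resolve_left hi
    rw [dif_neg hi, dif_pos hi']
    obtain ⟨j, hj⟩ : ∃ j, hi'.choose = j := ⟨_, rfl⟩
    have hψ : ψ j = i := by rw [← hj]; exact hi'.choose_spec
    rw [hj]
    have hw : wordOf φ i = false := (inIm_right_iff hp).1 hi'
    have hcj : countBefore false (wordOf φ) i = j := by rw [← hψ]; exact countBefore_right hp j
    rw [hw, hcj, hIic, prod_filter_lt_eq_prod_range,
      show countBefore true (wordOf φ) i = i - j by omega]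
    by_cases h0 : (i : ℕ) = 0
    · rw [if_pos (Or.inl h0), if_pos (Or.inl h0)]
      simp [shuffled, hw, hcj]
    · simp [h0, shuffled, hw, hcj]

/-- A strictly monotone map is determined by its range, so the set of places of `true` determines
both maps; conversely, the increasing enumerations of this set and its complement form a shuffle. -/
theorem sum_shuffles_eq_sum_words {M : Type*} [AddCommMonoid M] (k l : ℕ)
    (F : (Fin (k + l) → Bool) → M) :
    ∑ p ∈ shuffles k l, F (fun i => wordOf p.1 i) = ∑ e ∈ words (k + l) k, F e := by
  refine Finset.sum_bij (fun p _ i => wordOf p.1 i) ?_ ?_ ?_ (fun _ _ => rfl)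
  · rintro ⟨φ, ψ⟩ hp
    rw [mem_words]
    have : (Finset.univ.filter fun i : Fin (k + l) => wordOf φ i = true) =
        Finset.univ.image φ := by
      ext i
      simp [wordOf_eq_true_iff, Fin.ext_iff]
    rw [this, Finset.card_image_of_injective _ (mem_shuffles_iff.1 hp).1.injective]
    simp
  · rintro ⟨φ, ψ⟩ hp ⟨φ', ψ'⟩ hp' heq
    have h1 : ∀ i : Fin (k + l), wordOf φ i = wordOf φ' i := fun i => congrFun heq i
    have hφ : Set.range φ = Set.range φ' := by
      ext i
      exact inIm_left_iff.trans ((by rw [h1 i] : _ ↔ _).trans inIm_left_iff.symm)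
    have hψ : Set.range ψ = Set.range ψ' := by
      ext i
      exact (inIm_right_iff hp).trans ((by rw [h1 i] : _ ↔ _).trans (inIm_right_iff hp').symm)
    have hp1 := mem_shuffles_iff.1 hp
    have hp2 := mem_shuffles_iff.1 hp'
    rw [(hp1.1.range_inj hp2.1).1 hφ, (hp1.2.1.range_inj hp2.2.1).1 hψ]
  · intro e he
    rw [mem_words] at he
    set S := Finset.univ.filter fun i => e i = true with hS
    have hc : Sᶜ.card = l := by
      rw [Finset.card_compl, he, Fintype.card_fin, Nat.add_sub_cancel_left]
    refine ⟨(S.orderEmbOfFin he, Sᶜ.orderEmbOfFin hc), ?_, ?_⟩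
    · rw [mem_shuffles_iff]
      refine ⟨(S.orderEmbOfFin he).strictMono, (Sᶜ.orderEmbOfFin hc).strictMono, ?_, ?_⟩
      · rw [Finset.range_orderEmbOfFin, Finset.range_orderEmbOfFin, Finset.coe_compl]
        exact disjoint_compl_right
      · rw [Finset.range_orderEmbOfFin, Finset.range_orderEmbOfFin, Finset.coe_compl,
          Set.union_compl_self]
    · funext i
      have h1 : InIm (S.orderEmbOfFin he) i ↔ e i = true := by
        have : i ∈ Set.range (S.orderEmbOfFin he) ↔ i ∈ S := by
          rw [Finset.range_orderEmbOfFin]; rfl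
        exact this.trans (by simp [hS])
      rw [inIm_left_iff] at h1
      exact Bool.eq_iff_iff.2 h1

theorem summand_wordOf (hp : (φ, ψ) ∈ shuffles k l) {r : Fin k → ℕ} {s : Fin l → ℕ}
    {t : Fin (k + l) → ℕ} (hr : ∀ i, 1 ≤ r i) (hs : ∀ i, 1 ≤ s i) (ht : ∀ i, 1 ≤ t i)
    (w : Fin k → Circle) (z : Fin l → Circle) (N : ℕ) :
    summand (fun j => ((extendOne r j : ℕ) : ℤ)) (fun j => ((extendOne s j : ℕ) : ℤ))
        (extendOne w) (extendOne z) N t (fun i => wordOf φ i) =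
      ((∏ i, c r s t φ ψ i : ℕ) : ℂ) *
        term t (fun i => ((primedShuffle φ ψ w z i : Circle) : ℂ)) N := by
  have h1 := coef_eq_prod (k + l) (wordOf φ) (extendOne t) (fun j => ((extendOne r j : ℕ) : ℤ))
    (fun j => ((extendOne s j : ℕ) : ℤ))
  simp only [extendOne_val] at h1
  rw [summand, vec_eq_vecEntry, h1, Finset.prod_range]
  simp_rw [c_eq_coefFactor hp hr hs ht, primedShuffle_eq_vecEntry hp]

theorem sum_antidiagonal_term_mul_term_eq_sum_shuffles {r : Fin k → ℕ} {s : Fin l → ℕ}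
    (hr : ∀ i, 1 ≤ r i) (hs : ∀ i, 1 ≤ s i) (w : Fin k → Circle) (z : Fin l → Circle) (N : ℕ) :
    ∑ p ∈ Finset.HasAntidiagonal.antidiagonal N,
      term r (fun i => (w i : ℂ)) p.1 * term s (fun i => (z i : ℂ)) p.2 =
      ∑ t ∈ compositions (k + l) ((∑ i, r i) + ∑ i, s i), ∑ p ∈ shuffles k l,
        ((∏ i, c r s t p.1 p.2 i : ℕ) : ℂ) *
          term t (fun i => ((primedShuffle p.1 p.2 w z i : Circle) : ℂ)) N := by
  have h1 := sum_antidiagonal_term_mul_term (k := k) (l := l) rfl (extendOne r) (extendOne s)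
    (one_le_extendOne hr) (one_le_extendOne hs) (extendOne w) (extendOne z) N
  simp only [extendOne_val] at h1
  rw [h1]
  refine Finset.sum_congr rfl fun t ht => ?_
  rw [← sum_shuffles_eq_sum_words]
  refine Finset.sum_congr rfl fun p hp => ?_
  exact summand_wordOf hp hr hs (mem_compositions.1 ht).2 w z N

end Shuffles

/-! ### Convergence of the right-hand side and the identity of power series -/

section Main

variable {k l : ℕ}

/-- The first argument is w₁ or z₁. If t₁ = 1, a nonzero first factor forces the matching exponent
r₁ or s₁ to be 1, so that argument cannot be 1. -/
theorem converges_primedShuffle (hk : 0 < k) (hl : 0 < l) {r : Fin k → ℕ} {s : Fin l → ℕ}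
    (hr : ∀ i, 1 ≤ r i) (hs : ∀ i, 1 ≤ s i) {w : Fin k → Circle} {z : Fin l → Circle}
    (hw : (r ⟨0, hk⟩, w ⟨0, hk⟩) ≠ (1, 1)) (hz : (s ⟨0, hl⟩, z ⟨0, hl⟩) ≠ (1, 1))
    {t : Fin (k + l) → ℕ} (ht : ∀ i, 1 ≤ t i)
    {φ : Fin k → Fin (k + l)} {ψ : Fin l → Fin (k + l)} (hp : (φ, ψ) ∈ shuffles k l)
    (hc : ∏ i, c r s t φ ψ i ≠ 0) :
    Converges t (fun i => ((primedShuffle φ ψ w z i : Circle) : ℂ)) := by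
  have hkl : 0 < k + l := by omega
  refine converges_of_ne_one t _ hkl ht (fun i => Circle.norm_coe _) fun ht1 h1 => ?_
  rw [Circle.coe_eq_one, primedShuffle_eq_vecEntry hp] at h1
  have hc0 := Finset.prod_ne_zero_iff.1 hc ⟨0, hkl⟩ (Finset.mem_univ _)
  rw [c_eq_coefFactor hp hr hs ht] at hc0
  have hte : extendOne t 0 = 1 := by simpa [extendOne, hkl] using ht1
  simp only [vecEntry, coefFactor, true_or, if_true, shuffled, countBefore_zero, hte] at h1 hc0
  cases h0 : wordOf φ 0 with
  | true =>
    simp only [h0, if_true] at h1 hc0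
    have h2 : r ⟨0, hk⟩ = 1 := by
      by_contra hne
      refine hc0 (weight_of_lt ?_)
      have := hr ⟨0, hk⟩
      simp only [extendOne, hk, dif_pos]
      omega
    refine hw (Prod.ext h2 ?_)
    simpa [extendOne, hk] using h1
  | false =>
    simp only [h0, Bool.false_eq_true, if_false] at h1 hc0
    have h2 : s ⟨0, hl⟩ = 1 := by
      by_contra hne
      refine hc0 (weight_of_lt ?_)
      have := hs ⟨0, hl⟩
      simp only [extendOne, hl, dif_pos]
      omega
    refine hz (Prod.ext h2 ?_)
    simpa [extendOne, hl] using h1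

/-- Absolute convergence inside the disc permits the Cauchy product and the exchange of the finite
sums with the series. -/
theorem tsum_mul_tsum_eq_sum_shuffles {r : Fin k → ℕ} {s : Fin l → ℕ}
    (hr : ∀ i, 1 ≤ r i) (hs : ∀ i, 1 ≤ s i) (w : Fin k → Circle) (z : Fin l → Circle)
    {x : ℂ} (hx : ‖x‖ < 1) :
    (∑' n, term r (fun i => (w i : ℂ)) n * x ^ n) * ∑' n, term s (fun i => (z i : ℂ)) n * x ^ n =
      ∑ t ∈ compositions (k + l) ((∑ i, r i) + ∑ i, s i), ∑ p ∈ shuffles k l,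
        ((∏ i, c r s t p.1 p.2 i : ℕ) : ℂ) *
          ∑' n, term t (fun i => ((primedShuffle p.1 p.2 w z i : Circle) : ℂ)) n * x ^ n := by
  have hsum : ∀ t ∈ compositions (k + l) ((∑ i, r i) + ∑ i, s i), ∀ p ∈ shuffles k l,
      Summable fun n => ((∏ i, c r s t p.1 p.2 i : ℕ) : ℂ) *
        (term t (fun i => ((primedShuffle p.1 p.2 w z i : Circle) : ℂ)) n * x ^ n) :=
    fun t ht p _ => (summable_norm_term_mul_pow t _ (mem_compositions.1 ht).2
      (fun i => Circle.norm_coe _) hx).of_norm.mul_left _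
  rw [tsum_mul_tsum_eq_tsum_sum_antidiagonal_of_summable_norm
    (summable_norm_term_mul_pow r _ hr (fun i => Circle.norm_coe _) hx)
    (summable_norm_term_mul_pow s _ hs (fun i => Circle.norm_coe _) hx)]
  simp_rw [← tsum_mul_left]
  rw [Finset.sum_congr rfl fun t ht => (Summable.tsum_finsetSum (hsum t ht)).symm,
    ← Summable.tsum_finsetSum fun t ht => summable_sum (hsum t ht)]
  refine tsum_congr fun n => ?_
  have h1 : ∀ p ∈ Finset.HasAntidiagonal.antidiagonal n,
      term r (fun i => (w i : ℂ)) p.1 * x ^ p.1 * (term s (fun i => (z i : ℂ)) p.2 * x ^ p.2) =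
        term r (fun i => (w i : ℂ)) p.1 * term s (fun i => (z i : ℂ)) p.2 * x ^ n := by
    intro p hp
    rw [← Finset.HasAntidiagonal.mem_antidiagonal.1 hp, pow_add]
    ring
  rw [Finset.sum_congr rfl h1, ← Finset.sum_mul,
    sum_antidiagonal_term_mul_term_eq_sum_shuffles hr hs]
  simp_rw [Finset.sum_mul, mul_assoc]

end Main

end MPL

/-! ### Passage to the limit x → 1 -/

theorem mainTheorem4 (k l : ℕ) (hk : 0 < k) (hl : 0 < l)
    (r : Fin k → ℕ) (s : Fin l → ℕ) (hr : ∀ i, 1 ≤ r i) (hs : ∀ i, 1 ≤ s i)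
    (w : Fin k → Circle) (z : Fin l → Circle)
    (hw : (r ⟨0, hk⟩, w ⟨0, hk⟩) ≠ (1, 1)) (hz : (s ⟨0, hl⟩, z ⟨0, hl⟩) ≠ (1, 1)) :
    MPL.Converges r (fun i => (w i : ℂ)) ∧
    MPL.Converges s (fun i => (z i : ℂ)) ∧
    (∀ t ∈ MPL.compositions (k + l) ((∑ i, r i) + ∑ i, s i), ∀ p ∈ MPL.shuffles k l,
      ∏ i, MPL.c r s t p.1 p.2 i ≠ 0 →
        MPL.Converges t (fun i => ((MPL.primedShuffle p.1 p.2 w z i : Circle) : ℂ))) ∧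
    MPL.Li r (fun i => (w i : ℂ)) * MPL.Li s (fun i => (z i : ℂ)) =
      ∑ t ∈ MPL.compositions (k + l) ((∑ i, r i) + ∑ i, s i), ∑ p ∈ MPL.shuffles k l,
        ((∏ i, MPL.c r s t p.1 p.2 i : ℕ) : ℂ) *
          MPL.Li t (fun i => ((MPL.primedShuffle p.1 p.2 w z i : Circle) : ℂ)) := by
  have hcw : MPL.Converges r (fun i => (w i : ℂ)) :=
    MPL.converges_of_ne_one r _ hk hr (fun i => Circle.norm_coe _) fun h1 h2 =>
      hw (Prod.ext h1 (Circle.coe_eq_one.1 h2))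
  have hcz : MPL.Converges s (fun i => (z i : ℂ)) :=
    MPL.converges_of_ne_one s _ hl hs (fun i => Circle.norm_coe _) fun h1 h2 =>
      hz (Prod.ext h1 (Circle.coe_eq_one.1 h2))
  have hct : ∀ t ∈ MPL.compositions (k + l) ((∑ i, r i) + ∑ i, s i), ∀ p ∈ MPL.shuffles k l,
      ∏ i, MPL.c r s t p.1 p.2 i ≠ 0 →
        MPL.Converges t (fun i => ((MPL.primedShuffle p.1 p.2 w z i : Circle) : ℂ)) :=
    fun t ht p hp => MPL.converges_primedShuffle hk hl hr hs hw hz (MPL.mem_compositions.1 ht).2 hp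
  have hlim : Tendsto (fun x : ℂ =>
      ∑ t ∈ MPL.compositions (k + l) ((∑ i, r i) + ∑ i, s i), ∑ p ∈ MPL.shuffles k l,
        ((∏ i, MPL.c r s t p.1 p.2 i : ℕ) : ℂ) * ∑' n,
          MPL.term t (fun i => ((MPL.primedShuffle p.1 p.2 w z i : Circle) : ℂ)) n * x ^ n)
      ((𝓝[<] (1 : ℝ)).map Complex.ofReal)
      (𝓝 (∑ t ∈ MPL.compositions (k + l) ((∑ i, r i) + ∑ i, s i), ∑ p ∈ MPL.shuffles k l,
        ((∏ i, MPL.c r s t p.1 p.2 i : ℕ) : ℂ) *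
          MPL.Li t (fun i => ((MPL.primedShuffle p.1 p.2 w z i : Circle) : ℂ)))) := by
    refine tendsto_finsetSum _ fun t ht => tendsto_finsetSum _ fun p hp => ?_
    -- With coefficient 0 the series need not converge and `MPL.Li` may be a junk value; the factor
    -- 0 removes it before and after the limit.
    by_cases h0 : ∏ i, MPL.c r s t p.1 p.2 i = 0
    · simp only [h0, Nat.cast_zero, zero_mul]
      exact tendsto_const_nhds
    · exact (hct t ht p hp h0).tendsto_tsum.const_mul _
  refine ⟨hcw, hcz, hct, tendsto_nhds_unique_of_eventuallyEq
    (hcw.tendsto_tsum.mul hcz.tendsto_tsum) hlim ?_⟩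
  rw [EventuallyEq, eventually_map]
  -- The identity of power series is needed only for real x in (0, 1), where |x| < 1.
  filter_upwards [Ioo_mem_nhdsLT (show (0 : ℝ) < 1 by norm_num)] with x hx
  refine MPL.tsum_mul_tsum_eq_sum_shuffles hr hs w z ?_
  rw [Complex.norm_real, Real.norm_eq_abs, abs_of_pos hx.1]
  exact hx.2
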